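/- Let $X=(x_1,\dots,x_n)$ be distinct labeled points in $\mathbb{R}^d$ whose convex hull $P$ has dimension $d$. For $y\in\mathbb{R}^n$ and $t\in P$ let $h_{X,y}(t)$ be the largest real number $r$ such that $(t,r)\in\mathrm{conv}\{(x_1,y_1),\dots,(x_n,y_n)\}$, and let $f_{X,y}=\exp(h_{X,y})$ on $P$ and $f_{X,y}=0$ outside $P$. The vector $y$ is *relevant* if $h_{X,y}(x_i)=y_i$ for all $i$. The regular subdivision of $X$ induced by $y$ has one cell for each $d$-dimensional region of linearity of $h_{X,y}$, namely the set of labels $i$ such that $x_i$ lies in that region and $h_{X,y}(x_i)=y_i$. A *regular triangulation* is a regular subdivision (induced by some height vector) all of whose cells are vertex sets of simplices; it need not use all points of $X$. It *refines* the subdivision induced by $y$ if each of its cells is contained in a cell of that subdivision. Let $\mathrm{vol}(\sigma)$ denote $d!$ times the Lebesgue measure of $\mathrm{conv}\{x_i : i\in\sigma\}$. For finitely many variables $u_1,\dots,u_d$ let $$H(u_1,\dots,u_d)=(-1)^d\,\frac{1+u_1^{-1}+\cdots+u_d^{-1}}{u_1\cdots u_d}+\sum_{j=1}^d\frac{e^{u_j}}{u_j^2\prod_{k\ne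 j}(u_j-u_k)},$$ extended continuously to $\mathbb{R}^d$. Fix a relevant $y^*\in\mathbb{R}^n$ with $\int_{\mathbb{R}^d} f_{X,y^*}(t)\,dt=1$. Let $\Delta_1,\dots,\Delta_m$ be all regular triangulations of $X$ that refine the subdivision induced by $y^*$, and define $w^{\Delta_i}\in\mathbb{R}^n$ by $$w^{\Delta_i}_k=\sum_{\sigma\in\Delta_i,\;k\in\sigma}\mathrm{vol}(\sigma)\,\exp(y^*_k)\,H\bigl(\{y^*_j-y^*_k : j\in\sigma\setminus k\}\bigr).$$ Then each $w^{\Delta_i}$ is nonnegative, and $w^{\Delta_i}_k>0$ if and only if $x_k$ is a vertex of $\Delta_i$. Moreover, for every $w\in\mathbb{R}^n_{>0}$ the following are equivalent: (a) $w$ lies in the convex cone spanned by $w^{\Delta_1},\dots,w^{\Delta_m}$; (b) $f_{X,y^*}$ maximizes $\sum_i w_i\log f(x_i)$ over all integrable $f:\mathbb{R}^d\to\mathbb{R}_{\ge0}$ such that $\log f:\mathbb{R}^d\to\mathbb{R}\cup\{-\infty\}$ is concave and $\int_{\mathbb{R}^d} f=1$; (c) $y^*$ maximizes $w\cdot y$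 over $\{y\in\mathbb{R}^n : \int_P\exp(h_{X,y}(t))\,dt\le 1\}$; and, if in addition $\sum_i w_i=1$, they are also equivalent to (d) $y^*$ maximizes $w\cdot y-\int_P\exp(h_{X,y}(t))\,dt$ over $y\in\mathbb{R}^n$; (e) $y^*$ is optimal for the problem of maximizing $$w\cdot y-\sum_{\sigma\in\Delta}\sum_{i\in\sigma}\frac{\mathrm{vol}(\sigma)\exp(y_i)}{\prod_{j\in\sigma\setminus i}(y_i-y_j)}$$ (the inner sum over $i\in\sigma$ being extended continuously to coinciding $y_i$) over all pairs $(y,\Delta)$ where $y\in\mathbb{R}^n$ and $\Delta$ is a regular triangulation of $X$ that refines the subdivision induced by $y$ (equivalently, whose closed secondary cone contains $y$). In each of (b)–(e), if these conditions hold, the optimal solution is unique: in (b) the function $f_{X,y^*}$ is the only maximizer, in (c) and (d) the vector $y^*$ is the only maximizer, and in (e) the optimal pairs are exactly the feasible pairs $(y^*,\Delta)$. -/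

import Mathlib

namespace LogConcaveMLE

noncomputable section

/-! ### Optimization problems -/

/-- `a` is an optimal solution of: maximize `φ` over `S`. -/
def IsOptimal {α β : Type*} [Preorder β] (S : Set α) (φ : α → β) (a : α) : Prop :=
  a ∈ S ∧ ∀ b ∈ S, φ b ≤ φ a

/-- `a` is the optimal solution, i.e. the only one, of: maximize `φ` over `S`. -/
def IsUniqueOptimal {α β : Type*} [Preorder β] (S : Set α) (φ : α → β) (a : α) : Prop :=
  IsOptimal S φ a ∧ ∀ b, IsOptimal S φ b → b = a

/-! ### Point configurations, tent functions, regular subdivisions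

A configuration of `n` labeled points in `ℝ^d` is a map `X : Fin n → (Fin d → ℝ)`.
Subsets of the configuration are sets of labels. -/

variable {n d : ℕ}

/-- The polytope `P = conv(X)`. -/
def polytope (X : Fin n → Fin d → ℝ) : Set (Fin d → ℝ) :=
  convexHull ℝ (Set.range X)

/-- The tent function `h_{X,y}` on `P`: the largest `r` such that `(t, r)` lies in the convex hull
of the lifted points `(x_i, y_i)`. Outside `P` the mathematical value is `-∞`; the real number
returned there is meaningless, and the function is only ever used at points of `P`. -/
def tent (X : Fin n → Fin d → ℝ) (y : Fin n → ℝ) (t : Fin d → ℝ) : ℝ :=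
  sSup {r : ℝ | (t, r) ∈ convexHull ℝ (Set.range fun i => (X i, y i))}

/-- `y` is relevant if every `(x_i, y_i)` is a tent pole. -/
def IsRelevant (X : Fin n → Fin d → ℝ) (y : Fin n → ℝ) : Prop :=
  ∀ i, tent X y (X i) = y i

/-- The `d`-dimensional regions of linearity of `h_{X,y}`. As `h_{X,y}` is concave, the set where
it agrees with a given affine function is convex, and it is a maximal region as soon as it has
interior points. -/
def IsRegion (X : Fin n → Fin d → ℝ) (y : Fin n → ℝ) (R : Set (Fin d → ℝ)) : Prop :=
  ∃ ℓ : (Fin d → ℝ) →ᵃ[ℝ] ℝ,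
    R = {t | t ∈ polytope X ∧ tent X y t = ℓ t} ∧ (interior R).Nonempty

/-- The cells of the regular subdivision of `X` induced by `y`: for each region of linearity, the
set of (labels of) tent poles lying in it. The convex hull of these points is the region. -/
def subdivision (X : Fin n → Fin d → ℝ) (y : Fin n → ℝ) : Set (Finset (Fin n)) :=
  {C | ∃ R, IsRegion X y R ∧ ∀ i, i ∈ C ↔ X i ∈ R ∧ tent X y (X i) = y i}

/-- A regular triangulation, given by its maximal simplices: a regular subdivision each of whose
cells is (the vertex set of) a simplex. Not every point of `X` has to be a vertex of it. -/
def IsRegularTriangulation (X : Fin n → Fin d → ℝ) (Δ : Finset (Finset (Fin n))) : Prop :=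
  (∃ y : Fin n → ℝ, (Δ : Set (Finset (Fin n))) = subdivision X y) ∧
    ∀ σ ∈ Δ, AffineIndependent ℝ (fun i : σ => X i)

/-- `Δ` refines the subdivision induced by `y`: every cell of `Δ` is contained in a cell of the
latter. Equivalently, `y` lies in the (closed) secondary cone of `Δ`. -/
def Refines (X : Fin n → Fin d → ℝ) (Δ : Finset (Finset (Fin n))) (y : Fin n → ℝ) : Prop :=
  ∀ σ ∈ Δ, ∃ C ∈ subdivision X y, σ ⊆ C

/-- The regular triangulations that refine the subdivision induced by `y`. -/
def refiningTriangulations (X : Fin n → Fin d → ℝ) (y : Fin n → ℝ) :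
    Set (Finset (Finset (Fin n))) :=
  {Δ | IsRegularTriangulation X Δ ∧ Refines X Δ y}

/-- Normalized volume of `conv {x_i : i ∈ σ}`: `d!` times the Lebesgue measure. -/
def normVol (X : Fin n → Fin d → ℝ) (σ : Finset (Fin n)) : ℝ :=
  (d.factorial : ℝ) * (MeasureTheory.volume (convexHull ℝ (X '' (σ : Set (Fin n))))).toReal

/-! ### The symmetric function `H` and the weight vectors `w^Δ` -/

section Symmetric

variable {ι : Type*} [Fintype ι] [DecidableEq ι]

/-- The defining formula of `H`, meaningful when the `u_j` are nonzero and pairwise distinct. -/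
def HFormula (u : ι → ℝ) : ℝ :=
  (-1) ^ Fintype.card ι * ((1 + ∑ j, (u j)⁻¹) / ∏ j, u j)
    + ∑ j, Real.exp (u j) / (u j ^ 2 * ∏ k ∈ Finset.univ.erase j, (u j - u k))

/-- The function `H` on all of `ℝ^ι`: the continuous extension of the formula from the dense open
set where its denominators do not vanish. As `H` is symmetric, its arguments are indexed by an
arbitrary finite type. -/
def H : (ι → ℝ) → ℝ :=
  extendFrom {u | (∀ j, u j ≠ 0) ∧ Function.Injective u} HFormula

/-- `∑_i exp(z_i) / ∏_{j ≠ i} (z_i - z_j)`, meaningful when the `z_i` are pairwise distinct. -/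
def expSumFormula (z : ι → ℝ) : ℝ :=
  ∑ i, Real.exp (z i) / ∏ j ∈ Finset.univ.erase i, (z i - z j)

/-- The continuous extension of `expSumFormula` from the dense open set where its denominators
do not vanish. -/
def expSum : (ι → ℝ) → ℝ :=
  extendFrom {z | Function.Injective z} expSumFormula

end Symmetric

/-- The vector `w^Δ` for heights `y`:
`w_k = ∑_{σ ∈ Δ, k ∈ σ} vol(σ) exp(y_k) H({y_i - y_k : i ∈ σ \ k})`. -/
def weightVector (X : Fin n → Fin d → ℝ) (y : Fin n → ℝ) (Δ : Finset (Finset (Fin n))) :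
    Fin n → ℝ :=
  fun k => ∑ σ ∈ Δ with k ∈ σ,
    normVol X σ * Real.exp (y k) * H (fun i : (σ.erase k : Finset (Fin n)) => y i - y k)

/-! ### The four optimization problems -/

/-- `log f : ℝ^d → ℝ ∪ {-∞}` for `f ≥ 0`, with `log 0 = -∞`. -/
def elog (f : (Fin d → ℝ) → ℝ) (t : Fin d → ℝ) : EReal :=
  ENNReal.log (ENNReal.ofReal (f t))

/-- `f` is a log-concave probability density on `ℝ^d`. -/
def IsLogConcaveDensity (f : (Fin d → ℝ) → ℝ) : Prop :=
  (∀ t, 0 ≤ f t) ∧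
  (∀ s t : Fin d → ℝ, ∀ a b : ℝ, 0 < a → 0 < b → a + b = 1 →
    (a : EReal) * elog f s + (b : EReal) * elog f t ≤ elog f (a • s + b • t)) ∧
  MeasureTheory.Integrable f ∧ ∫ t, f t = 1

/-- The log-likelihood `∑ w_i log f(x_i)`, with values in `ℝ ∪ {-∞}`. -/
def logLikelihood (X : Fin n → Fin d → ℝ) (w : Fin n → ℝ) (f : (Fin d → ℝ) → ℝ) : EReal :=
  ∑ i, (w i : EReal) * elog f (X i)

open Classical in
/-- The function `f_{X,y}`, equal to `exp(h_{X,y})` on `P` and to `0` outside `P`. -/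
def density (X : Fin n → Fin d → ℝ) (y : Fin n → ℝ) (t : Fin d → ℝ) : ℝ :=
  if t ∈ polytope X then Real.exp (tent X y t) else 0

/-- `∫_P exp(h_{X,y}(t)) dt`. -/
def tentIntegral (X : Fin n → Fin d → ℝ) (y : Fin n → ℝ) : ℝ :=
  ∫ t in polytope X, Real.exp (tent X y t)

/-- The Samworth body. -/
def samworthBody (X : Fin n → Fin d → ℝ) : Set (Fin n → ℝ) :=
  {y | tentIntegral X y ≤ 1}

/-- Objective `w · y - ∫_P exp(h_{X,y})` of the unconstrained problem. -/
def unconstrainedObjective (X : Fin n → Fin d → ℝ) (w y : Fin n → ℝ) : ℝ :=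
  w ⬝ᵥ y - tentIntegral X y

/-- Feasible pairs `(y, Δ)` of the triangulation problem: `y` is arbitrary and `Δ` is a regular
triangulation whose secondary cone contains `y`. -/
def triangulationPairs (X : Fin n → Fin d → ℝ) :
    Set ((Fin n → ℝ) × Finset (Finset (Fin n))) :=
  {p | p.2 ∈ refiningTriangulations X p.1}

/-- Objective `w · y - ∑_{σ ∈ Δ} ∑_{i ∈ σ} vol(σ) exp(y_i) / ∏_{j ∈ σ \ i} (y_i - y_j)` of the
triangulation problem, removable singularities being filled in by continuity. -/
def triangulationObjective (X : Fin n → Fin d → ℝ) (w : Fin n → ℝ)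
    (p : (Fin n → ℝ) × Finset (Finset (Fin n))) : ℝ :=
  w ⬝ᵥ p.1 - ∑ σ ∈ p.2, normVol X σ * expSum (fun i : σ => p.1 i)

end

end LogConcaveMLE

open MeasureTheory Set

namespace LogConcaveMLE

noncomputable section

/-! ### Integrals over the corner simplex -/

/-! The theorem describes the subdifferential at `y` of the convex function `T z = tentIntegral X
z`. If `Δ` refines the subdivision induced by `z`, the tent is on each simplex of `Δ` the affine
interpolant `∑ z k * bary k`, and differentiating `T` formally in `z k` gives `∑ σ, ∫ bary k * exp
(interp z)`. The Hermite–Genocchi formula turns this into the formula with `H`: `H` is a moment of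
the exponential over the corner simplex, hence continuous and positive (`H_eq_cornerMoment`,
`weightVector_eq_sum`).

Each weight vector is a subgradient (`tentIntegral_subgradient`): the tent of `z` lies above every
interpolant of `z`, and `exp a + b * exp a ≤ exp (a + b)`. The inequality is strict as soon as `z`
and `y` differ at a vertex of `Δ`. The entries of a weight vector sum to `T y = 1`, so a vector of
the cone is a subgradient scaled by its total mass, and positivity of `w` makes it strict for every
`z ≠ y`. This gives all the uniqueness claims.

Conversely, a scaled subgradient outside the cone is separated from the finitely many weight vectors
by a direction `v`. One triangulation refines infinitely many of the heights `y + ε v` with `ε → 0`,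
hence refines `y` too; monotonicity and continuity of the weight vectors then contradict the
separation (`mem_cone_of_subgradient`).

Adding constants to heights and `log x ≤ x - 1` relate the constrained problem to the subgradient
inequality. The density problem reduces to heights because a log-concave `f` dominates the tent
density with heights `log f (x_i)` (`logLikelihood_le`). The triangulation problem has the
unconstrained objective in disguise (`triangulationObjective_eq`). -/

/-- The corner simplex `{s ≥ 0, ∑ s ≤ r}` in `ℝ^d`. -/
def cornerSimplex (d : ℕ) (r : ℝ) : Set (Fin d → ℝ) :=
  {s | (∀ j, 0 ≤ s j) ∧ ∑ j, s j ≤ r}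

lemma isClosed_setOf_cornerSimplex (d : ℕ) :
    IsClosed {p : ℝ × (Fin d → ℝ) | p.2 ∈ cornerSimplex d p.1} := by
  have : {p : ℝ × (Fin d → ℝ) | p.2 ∈ cornerSimplex d p.1} =
      (⋂ j, {p : ℝ × (Fin d → ℝ) | 0 ≤ p.2 j}) ∩ {p | ∑ j, p.2 j ≤ p.1} := by
    ext p; simp [cornerSimplex]
  rw [this]
  refine (isClosed_iInter fun j => isClosed_le (by fun_prop) (by fun_prop)).inter
    (isClosed_le (by fun_prop) (by fun_prop))

lemma isCompact_cornerSimplex (d : ℕ) (r : ℝ) : IsCompact (cornerSimplex d r) := by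
  have hc : IsClosed (cornerSimplex d r) :=
    (isClosed_setOf_cornerSimplex d).preimage (f := fun s => (r, s)) (by fun_prop)
  refine (isCompact_Icc (a := (0 : Fin d → ℝ)) (b := fun _ => r)).of_isClosed_subset hc ?_
  intro s hs
  refine ⟨fun j => hs.1 j, fun j => le_trans ?_ hs.2⟩
  exact Finset.single_le_sum (fun i _ => hs.1 i) (Finset.mem_univ j)

lemma measurableSet_cornerSimplex (d : ℕ) (r : ℝ) : MeasurableSet (cornerSimplex d r) :=
  (isCompact_cornerSimplex d r).isClosed.measurableSet

lemma cons_mem_cornerSimplex {d : ℕ} {r a : ℝ} {s : Fin d → ℝ} :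
    (Fin.cons a s : Fin (d + 1) → ℝ) ∈ cornerSimplex (d + 1) r ↔
      0 ≤ a ∧ s ∈ cornerSimplex d (r - a) := by
  simp only [cornerSimplex, mem_ofPred_eq, Fin.forall_fin_succ, Fin.cons_zero, Fin.cons_succ,
    Fin.sum_univ_succ, and_assoc, le_sub_iff_add_le']

lemma cornerSimplex_eq_empty {d : ℕ} {r : ℝ} (hr : r < 0) : cornerSimplex d r = ∅ := by
  ext s
  simp only [cornerSimplex, mem_ofPred_eq, mem_empty_iff_false, iff_false, not_and, not_le]
  intro h
  exact hr.trans_le (Finset.sum_nonneg fun j _ => h j)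

lemma measurePreserving_cons (d : ℕ) :
    MeasurePreserving (fun p : ℝ × (Fin d → ℝ) => (Fin.cons p.1 p.2 : Fin (d + 1) → ℝ)) := by
  have := (volume_preserving_piFinSuccAbove (fun _ : Fin (d + 1) => ℝ) 0).symm
  convert this using 1
  ext p : 1
  exact (Fin.insertNth_zero' p.1 p.2).symm

lemma measurableEmbedding_cons (d : ℕ) :
    MeasurableEmbedding (fun p : ℝ × (Fin d → ℝ) => (Fin.cons p.1 p.2 : Fin (d + 1) → ℝ)) := by
  have := (MeasurableEquiv.piFinSuccAbove (fun _ : Fin (d + 1) => ℝ) 0).symm.measurableEmbedding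
  convert this using 1
  ext p : 1
  exact (Fin.insertNth_zero' p.1 p.2).symm

/-- The corner simplex of dimension `d + 1`, in product coordinates. -/
def cornerProd (d : ℕ) (r : ℝ) : Set (ℝ × (Fin d → ℝ)) :=
  {p | 0 ≤ p.1 ∧ p.2 ∈ cornerSimplex d (r - p.1)}

lemma setIntegral_cornerSimplex_succ {d : ℕ} (r : ℝ) (g : (Fin (d + 1) → ℝ) → ℝ) :
    ∫ s in cornerSimplex (d + 1) r, g s =
      ∫ p, (cornerProd d r).indicator (fun p => g (Fin.cons p.1 p.2)) p := by
  rw [integral_indicator, ← (measurePreserving_cons d).setIntegral_preimage_emb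
    (measurableEmbedding_cons d)]
  · congr 2
    ext p
    exact cons_mem_cornerSimplex
  · have : cornerProd d r = (fun p : ℝ × (Fin d → ℝ) => (Fin.cons p.1 p.2 : Fin (d + 1) → ℝ)) ⁻¹'
        cornerSimplex (d + 1) r := by
      ext p; exact cons_mem_cornerSimplex.symm
    rw [this]
    exact (measurePreserving_cons d).measurable (measurableSet_cornerSimplex _ _)

lemma integrable_indicator_cornerProd {d : ℕ} (r : ℝ) {g : (Fin (d + 1) → ℝ) → ℝ}
    (hg : Continuous g) :
    Integrable ((cornerProd d r).indicator (fun p => g (Fin.cons p.1 p.2))) := by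
  have h : IntegrableOn g (cornerSimplex (d + 1) r) :=
    hg.continuousOn.integrableOn_compact (isCompact_cornerSimplex _ _)
  rw [← integrable_indicator_iff (measurableSet_cornerSimplex _ _)] at h
  have h2 := ((measurePreserving_cons d).integrable_comp_emb (measurableEmbedding_cons d)).2 h
  refine h2.congr (Filter.Eventually.of_forall fun p => ?_)
  classical exact if_congr cons_mem_cornerSimplex rfl rfl

/-- Fubini with the first coordinate outermost: the slices are again corner simplices, which makes
induction on the dimension possible. -/
lemma setIntegral_cornerSimplex_succ_left {d : ℕ} {r : ℝ} (hr : 0 ≤ r)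
    {g : (Fin (d + 1) → ℝ) → ℝ} (hg : Continuous g) :
    ∫ s in cornerSimplex (d + 1) r, g s =
      ∫ a in (0 : ℝ)..r, ∫ s in cornerSimplex d (r - a), g (Fin.cons a s) := by
  rw [setIntegral_cornerSimplex_succ, Measure.volume_eq_prod,
    integral_prod _ (integrable_indicator_cornerProd r hg),
    intervalIntegral.integral_of_le hr, ← integral_Icc_eq_integral_Ioc,
    ← integral_indicator measurableSet_Icc]
  congr 1
  ext a
  by_cases ha : a ∈ Icc 0 r
  · rw [indicator_of_mem ha, ← integral_indicator (measurableSet_cornerSimplex _ _)]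
    congr 1
    ext s
    have : (a, s) ∈ cornerProd d r ↔ s ∈ cornerSimplex d (r - a) := and_iff_right ha.1
    classical exact if_congr this rfl rfl
  · rw [indicator_of_notMem ha]
    have : ∀ s, (a, s) ∉ cornerProd d r := by
      rintro s ⟨h0, h1⟩
      by_cases har : a ≤ r
      · exact ha ⟨h0, har⟩
      · rw [cornerSimplex_eq_empty (by push Not at har; simpa using har)] at h1
        exact h1
    simp [this]

/-- Fubini in the other order. For an integrand independent of the first coordinate, the inner
integral produces the factor `r - ∑ s` of `cornerMoment`. -/
lemma setIntegral_cornerSimplex_succ_right {d : ℕ} {r : ℝ}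
    {g : (Fin (d + 1) → ℝ) → ℝ} (hg : Continuous g) :
    ∫ s in cornerSimplex (d + 1) r, g s =
      ∫ s in cornerSimplex d r, ∫ a in (0 : ℝ)..(r - ∑ j, s j), g (Fin.cons a s) := by
  rw [setIntegral_cornerSimplex_succ, Measure.volume_eq_prod,
    integral_prod_symm _ (integrable_indicator_cornerProd r hg),
    ← integral_indicator (measurableSet_cornerSimplex _ _)]
  congr 1
  ext s
  by_cases hs : s ∈ cornerSimplex d r
  · rw [indicator_of_mem hs, intervalIntegral.integral_of_le (by linarith [hs.2]),
      ← integral_Icc_eq_integral_Ioc, ← integral_indicator measurableSet_Icc]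
    congr 1
    ext a
    have : (a, s) ∈ cornerProd d r ↔ a ∈ Icc 0 (r - ∑ j, s j) := by
      simp only [cornerProd, cornerSimplex, mem_ofPred_eq, mem_Icc, hs.1, implies_true, true_and]
      constructor <;> rintro ⟨h, h'⟩ <;> exact ⟨h, by linarith⟩
    simp only [indicator, this]
  · rw [indicator_of_notMem hs]
    have : ∀ a, (a, s) ∉ cornerProd d r := by
      rintro a ⟨h0, h1, h2⟩
      exact hs ⟨h1, by linarith⟩
    simp [this]

/-- `∫ exp (s · u)` over the corner simplex. -/
def cornerIntegral {d : ℕ} (u : Fin d → ℝ) (r : ℝ) : ℝ :=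
  ∫ s in cornerSimplex d r, Real.exp (∑ j, s j * u j)

lemma cornerIntegral_succ {d : ℕ} (u : Fin (d + 1) → ℝ) {r : ℝ} (hr : 0 ≤ r) :
    cornerIntegral u r =
      ∫ a in (0 : ℝ)..r, Real.exp (a * u 0) * cornerIntegral (Fin.tail u) (r - a) := by
  unfold cornerIntegral
  rw [setIntegral_cornerSimplex_succ_left hr (by fun_prop)]
  simp only [Fin.sum_univ_succ, Fin.cons_zero, Fin.cons_succ, Real.exp_add, integral_const_mul]
  rfl

lemma cornerIntegral_fin_zero (u : Fin 0 → ℝ) {r : ℝ} (hr : 0 ≤ r) : cornerIntegral u r = 1 := by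
  have : cornerSimplex 0 r = univ := by
    ext s; simp [cornerSimplex, hr]
  simp [cornerIntegral, this, Measure.real, volume_pi]

/-- The volume of the corner simplex. -/
lemma cornerIntegral_zero (d : ℕ) {r : ℝ} (hr : 0 ≤ r) :
    cornerIntegral (0 : Fin d → ℝ) r = r ^ d / d.factorial := by
  induction d generalizing r with
  | zero => simpa using cornerIntegral_fin_zero _ hr
  | succ d ih =>
    rw [cornerIntegral_succ _ hr]
    have : ∫ a in (0 : ℝ)..r, Real.exp (a * (0 : Fin (d + 1) → ℝ) 0) *
        cornerIntegral (Fin.tail (0 : Fin (d + 1) → ℝ)) (r - a) =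
        ∫ a in (0 : ℝ)..r, (r - a) ^ d / d.factorial := by
      refine intervalIntegral.integral_congr fun a ha => ?_
      rw [uIcc_of_le hr] at ha
      have h0 : Fin.tail (0 : Fin (d + 1) → ℝ) = 0 := rfl
      simp only [Pi.zero_apply, mul_zero, Real.exp_zero, one_mul, h0]
      exact ih (by linarith [ha.2])
    rw [this, intervalIntegral.integral_comp_sub_left (fun a => a ^ d / (d.factorial : ℝ)) r]
    simp only [sub_self, sub_zero, intervalIntegral.integral_div, integral_pow]
    rw [Nat.factorial_succ]
    have : (d.factorial : ℝ) ≠ 0 := by positivity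
    push_cast
    field_simp
    simp

/-! ### Divided differences of the exponential -/

/-- The divided difference of `x ↦ exp (r x)` at the points of `A`. -/
def dividedExp (A : Finset ℝ) (r : ℝ) : ℝ :=
  ∑ a ∈ A, Real.exp (r * a) / ∏ b ∈ A.erase a, (a - b)

lemma prod_erase_sub_ne_zero (A : Finset ℝ) (a : ℝ) : ∏ b ∈ A.erase a, (a - b) ≠ 0 :=
  Finset.prod_ne_zero_iff.2 fun _ hb => sub_ne_zero.2 (Finset.ne_of_mem_erase hb).symm

/-- Partial fractions of `1 / ∏ (c - a)`. -/
lemma sum_inv_prod_erase {A : Finset ℝ} (hA : A.Nonempty) {c : ℝ} (hc : c ∉ A) :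
    ∑ a ∈ A, ((c - a) * ∏ b ∈ A.erase a, (a - b))⁻¹ = (∏ a ∈ A, (c - a))⁻¹ := by
  -- The Lagrange basis polynomials sum to `1`; evaluate this at `c`.
  have h := congrArg (Polynomial.eval c)
    (Lagrange.sum_basis (s := A) (v := id) Function.injective_id.injOn hA)
  rw [Polynomial.eval_finsetSum, Polynomial.eval_one] at h
  have hne : ∀ a ∈ A, c ≠ a := fun a ha h => hc (h ▸ ha)
  have h2 : ∑ a ∈ A, Polynomial.eval c (Lagrange.basis A id a) =
      (∏ a ∈ A, (c - a)) * ∑ a ∈ A, ((c - a) * ∏ b ∈ A.erase a, (a - b))⁻¹ := by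
    rw [Finset.mul_sum]
    refine Finset.sum_congr rfl fun a ha => ?_
    rw [Lagrange.eval_basis_not_at_node ha (hne a ha), Lagrange.eval_nodal, Lagrange.nodalWeight,
      Finset.prod_inv_distrib, mul_inv, mul_comm (c - a)⁻¹]
    rfl
  rw [h2] at h
  exact eq_inv_of_mul_eq_one_right h

/-- Integrating term by term leaves the old exponentials with one more factor in the denominator,
plus multiples of `exp (r * c)` whose coefficients are collected by partial fractions. This is the
same convolution recursion as `cornerIntegral_succ`. -/
lemma dividedExp_insert {A : Finset ℝ} (hA : A.Nonempty) {c : ℝ} (hc : c ∉ A) (r : ℝ) :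
    dividedExp (insert c A) r = ∫ a in (0 : ℝ)..r, Real.exp (a * c) * dividedExp A (r - a) := by
  have hne : ∀ a ∈ A, c - a ≠ 0 := fun a ha h => hc (sub_eq_zero.1 h ▸ ha)
  have h1 : ∫ s in (0 : ℝ)..r, Real.exp (s * c) * dividedExp A (r - s) =
      ∑ a ∈ A, ∫ s in (0 : ℝ)..r, (Real.exp (r * a) / ∏ b ∈ A.erase a, (a - b)) *
        Real.exp ((c - a) * s) := by
    rw [← intervalIntegral.integral_finsetSum]
    · refine intervalIntegral.integral_congr fun s _ => ?_
      simp only [dividedExp, Finset.mul_sum]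
      refine Finset.sum_congr rfl fun a _ => ?_
      rw [mul_div_assoc', div_mul_eq_mul_div, ← Real.exp_add, ← Real.exp_add]
      ring_nf
    · intro a _
      exact (by fun_prop : Continuous _).intervalIntegrable _ _
  have h2 : ∀ a ∈ A, ∫ s in (0 : ℝ)..r, (Real.exp (r * a) / ∏ b ∈ A.erase a, (a - b)) *
        Real.exp ((c - a) * s) =
      Real.exp (r * c) * ((c - a) * ∏ b ∈ A.erase a, (a - b))⁻¹ +
        Real.exp (r * a) / ((a - c) * ∏ b ∈ A.erase a, (a - b)) := by
    intro a ha
    rw [intervalIntegral.integral_const_mul,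
      intervalIntegral.integral_comp_mul_left (fun x => Real.exp x) (hne a ha), integral_exp]
    have hp := prod_erase_sub_ne_zero A a
    have hca := hne a ha
    have hac : a - c ≠ 0 := by rw [← neg_sub]; exact neg_ne_zero.2 hca
    have he : Real.exp (r * c) = Real.exp (r * a) * Real.exp ((c - a) * r) := by
      rw [← Real.exp_add]; ring_nf
    rw [he, mul_zero, Real.exp_zero, smul_eq_mul]
    have : a - c = -(c - a) := by ring
    rw [this]
    field_simp
    ring
  rw [h1, Finset.sum_congr rfl h2, Finset.sum_add_distrib, ← Finset.mul_sum,
    sum_inv_prod_erase hA hc, dividedExp, Finset.sum_insert hc, Finset.erase_insert hc,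
    div_eq_mul_inv]
  congr 1
  refine Finset.sum_congr rfl fun a ha => ?_
  have hca : c ≠ a := fun h => hc (h ▸ ha)
  rw [Finset.erase_insert_of_ne hca, Finset.prod_insert (fun h => hc (Finset.mem_of_mem_erase h))]

/-- The Hermite–Genocchi formula. -/
lemma cornerIntegral_eq_dividedExp {d : ℕ} (u : Fin d → ℝ) (h0 : ∀ j, u j ≠ 0)
    (hu : Function.Injective u) {r : ℝ} (hr : 0 ≤ r) :
    cornerIntegral u r = dividedExp (insert 0 (Finset.univ.image u)) r := by
  induction d generalizing r with
  | zero =>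
    rw [cornerIntegral_fin_zero _ hr]
    simp [dividedExp]
  | succ d ih =>
    have himg : Finset.univ.image u = insert (u 0) (Finset.univ.image (Fin.tail u)) := by
      ext a
      simp only [Finset.mem_image, Finset.mem_univ, true_and, Finset.mem_insert, Fin.exists_fin_succ,
        Fin.tail, eq_comm]
    have hnot : u 0 ∉ insert 0 (Finset.univ.image (Fin.tail u)) := by
      simp only [Finset.mem_insert, Finset.mem_image, Finset.mem_univ, true_and, not_or, not_exists]
      exact ⟨h0 0, fun j hj => absurd (hu hj) (Fin.succ_ne_zero j)⟩
    rw [cornerIntegral_succ _ hr, himg, Finset.insert_comm,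
      dividedExp_insert (Finset.insert_nonempty _ _) hnot]
    refine intervalIntegral.integral_congr fun a ha => ?_
    rw [uIcc_of_le hr] at ha
    rw [ih (Fin.tail u) (fun j => h0 _) (fun i j h => Fin.succ_injective _ (hu h))
      (by linarith [ha.2])]

/-- The derivative at `c = 0` of the partial fraction identity `sum_inv_prod_erase`. -/
lemma sum_inv_sq_prod_erase {A : Finset ℝ} (hA : A.Nonempty) (h0 : (0 : ℝ) ∉ A) :
    ∑ a ∈ A, (a ^ 2 * ∏ b ∈ A.erase a, (a - b))⁻¹ =
      -((-1) ^ A.card * ((∑ a ∈ A, a⁻¹) / ∏ a ∈ A, a)) := by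
  have hne : ∀ a ∈ A, (0 : ℝ) - a ≠ 0 := fun a ha h => h0 (by simp at h; exact h ▸ ha)
  have hd1 : HasDerivAt (fun c : ℝ => ∑ a ∈ A, (∏ b ∈ A.erase a, (a - b))⁻¹ * (c - a)⁻¹)
      (∑ a ∈ A, (∏ b ∈ A.erase a, (a - b))⁻¹ * (-1 / (0 - a) ^ 2)) 0 := by
    refine HasDerivAt.fun_sum fun a ha => ?_
    exact (((hasDerivAt_id (0 : ℝ)).sub_const a).fun_inv (hne a ha)).const_mul _
  have hd2 : HasDerivAt (fun c : ℝ => (∏ a ∈ A, (c - a))⁻¹)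
      (-(∑ a ∈ A, (∏ b ∈ A.erase a, (0 - b)) • 1) / (∏ a ∈ A, (0 - a)) ^ 2) 0 := by
    refine HasDerivAt.fun_inv (HasDerivAt.fun_finsetProd fun a _ => ?_)
      (Finset.prod_ne_zero_iff.2 hne)
    exact (hasDerivAt_id (0 : ℝ)).sub_const a
  have heq : (fun c : ℝ => ∑ a ∈ A, (∏ b ∈ A.erase a, (a - b))⁻¹ * (c - a)⁻¹) =ᶠ[nhds 0]
      (fun c : ℝ => (∏ a ∈ A, (c - a))⁻¹) := by
    have : ∀ᶠ c : ℝ in nhds 0, c ∉ A :=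
      A.finite_toSet.isClosed.isOpen_compl.mem_nhds (by simpa using h0)
    filter_upwards [this] with c hc
    rw [← sum_inv_prod_erase hA hc]
    exact Finset.sum_congr rfl fun a _ => by rw [mul_inv, mul_comm]
  have h := hd1.unique (hd2.congr_of_eventuallyEq heq)
  have e1 : ∑ a ∈ A, (∏ b ∈ A.erase a, (a - b))⁻¹ * (-1 / (0 - a) ^ 2) =
      -∑ a ∈ A, (a ^ 2 * ∏ b ∈ A.erase a, (a - b))⁻¹ := by
    rw [← Finset.sum_neg_distrib]
    refine Finset.sum_congr rfl fun a ha => ?_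
    rw [mul_inv]; ring
  have e2 : (∑ a ∈ A, (∏ b ∈ A.erase a, (0 - b)) • (1 : ℝ)) =
      (∏ a ∈ A, (0 - a)) * ∑ a ∈ A, (0 - a)⁻¹ := by
    rw [Finset.mul_sum]
    refine Finset.sum_congr rfl fun a ha => ?_
    rw [← Finset.mul_prod_erase A _ ha, smul_eq_mul, mul_one]
    have := hne a ha
    field_simp
  rw [e1, e2] at h
  have e3 : ∏ a ∈ A, ((0 : ℝ) - a) = (-1) ^ A.card * ∏ a ∈ A, a := by
    rw [← Finset.prod_const, ← Finset.prod_mul_distrib]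
    exact Finset.prod_congr rfl fun a _ => by ring
  have e4 : ∑ a ∈ A, ((0 : ℝ) - a)⁻¹ = -∑ a ∈ A, a⁻¹ := by
    rw [← Finset.sum_neg_distrib]
    exact Finset.sum_congr rfl fun a _ => by rw [zero_sub, inv_neg]
  have hp : ∏ a ∈ A, ((0 : ℝ) - a) ≠ 0 := Finset.prod_ne_zero_iff.2 hne
  have hp' : ∏ a ∈ A, a ≠ 0 := by
    rw [e3] at hp; exact right_ne_zero_of_mul hp
  rw [neg_eq_iff_eq_neg] at h
  rw [h, e4, e3]
  rcases neg_one_pow_eq_or ℝ A.card with h1 | h1 <;> rw [h1] <;> field_simp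

/-! ### The functions `H` and `expSum` as integrals -/

/-- `∫ (1 - ∑ s) exp (s · u)` over the unit corner simplex. -/
def cornerMoment {d : ℕ} (u : Fin d → ℝ) : ℝ :=
  ∫ s in cornerSimplex d 1, (1 - ∑ j, s j) * Real.exp (∑ j, s j * u j)

lemma continuous_cornerMoment (d : ℕ) : Continuous (cornerMoment (d := d)) :=
  continuous_parametric_integral_of_continuous
    (f := fun u s : Fin d → ℝ => (1 - ∑ j, s j) * Real.exp (∑ j, s j * u j))
    (by unfold Function.uncurry; fun_prop) (isCompact_cornerSimplex d 1)

lemma continuous_cornerIntegral (d : ℕ) (r : ℝ) :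
    Continuous (fun u : Fin d → ℝ => cornerIntegral u r) :=
  continuous_parametric_integral_of_continuous
    (f := fun u s : Fin d → ℝ => Real.exp (∑ j, s j * u j))
    (by unfold Function.uncurry; fun_prop) (isCompact_cornerSimplex d r)

/-- Both sides are the two Fubini orders of one `(d + 1)`-dimensional corner integral, whose
additional exponent is `0`. -/
lemma cornerMoment_eq_integral {d : ℕ} (u : Fin d → ℝ) :
    cornerMoment u = ∫ r in (0 : ℝ)..1, cornerIntegral u r := by
  have h1 := setIntegral_cornerSimplex_succ_right (d := d) (r := 1)
    (g := fun s => Real.exp (∑ j, s j * (Fin.cons 0 u : Fin (d + 1) → ℝ) j)) (by fun_prop)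
  have h2 := cornerIntegral_succ (Fin.cons 0 u : Fin (d + 1) → ℝ) zero_le_one
  rw [cornerIntegral, h1] at h2
  simp only [Fin.sum_univ_succ, Fin.cons_zero, Fin.cons_succ, mul_zero, zero_add, Real.exp_zero,
    one_mul, Fin.tail_cons, intervalIntegral.integral_const, sub_zero, smul_eq_mul] at h2
  rw [cornerMoment, h2, intervalIntegral.integral_comp_sub_left (fun r => cornerIntegral u r)]
  simp

lemma cornerMoment_pos {d : ℕ} (u : Fin d → ℝ) : 0 < cornerMoment u := by
  have hcont : Continuous fun s : Fin d → ℝ => (1 - ∑ j, s j) * Real.exp (∑ j, s j * u j) := by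
    fun_prop
  have hnn : ∀ s ∈ cornerSimplex d 1, 0 ≤ (1 - ∑ j, s j) * Real.exp (∑ j, s j * u j) :=
    fun s hs => mul_nonneg (by linarith [hs.2]) (Real.exp_pos _).le
  rw [cornerMoment, setIntegral_pos_iff_support_of_nonneg_ae
    ((ae_restrict_mem (measurableSet_cornerSimplex d 1)).mono hnn)
    (hcont.continuousOn.integrableOn_compact (isCompact_cornerSimplex d 1))]
  have hU : IsOpen {s : Fin d → ℝ | (∀ j, 0 < s j) ∧ ∑ j, s j < 1} := by
    have : {s : Fin d → ℝ | (∀ j, 0 < s j) ∧ ∑ j, s j < 1} =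
        (⋂ j, {s : Fin d → ℝ | 0 < s j}) ∩ {s | ∑ j, s j < 1} := by
      ext; simp
    rw [this]
    exact (isOpen_iInter_of_finite fun j => isOpen_lt (by fun_prop) (by fun_prop)).inter
      (isOpen_lt (by fun_prop) (by fun_prop))
  have hne : {s : Fin d → ℝ | (∀ j, 0 < s j) ∧ ∑ j, s j < 1}.Nonempty := by
    -- The barycentre of the corner simplex; its coordinates sum to `d / (d + 1)`.
    refine ⟨fun _ => ((d : ℝ) + 1)⁻¹, fun _ => by positivity, ?_⟩
    rw [Finset.sum_const, Finset.card_univ, Fintype.card_fin, nsmul_eq_mul, ← div_eq_mul_inv,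
      div_lt_one (by positivity)]
    linarith
  refine (hU.measure_pos volume hne).trans_le (measure_mono fun s hs => ⟨?_, ?_⟩)
  · exact mul_ne_zero (by linarith [hs.2]) (Real.exp_pos _).ne'
  · exact ⟨fun j => (hs.1 j).le, hs.2.le⟩

section
variable {ι : Type*} [Fintype ι] [DecidableEq ι]

lemma prod_erase_image {u : ι → ℝ} (hu : Function.Injective u) (i : ι) :
    ∏ b ∈ (Finset.univ.image u).erase (u i), (u i - b) =
      ∏ j ∈ Finset.univ.erase i, (u i - u j) := by
  rw [← Finset.image_erase hu, Finset.prod_image hu.injOn]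

lemma expSumFormula_eq {z : ι → ℝ} (hz : Function.Injective z) :
    expSumFormula z = dividedExp (Finset.univ.image z) 1 := by
  rw [expSumFormula, dividedExp, Finset.sum_image hz.injOn]
  refine Finset.sum_congr rfl fun i _ => ?_
  rw [prod_erase_image hz, one_mul]

/-- Integrating `exp (a * r)` over `[0, 1]` gives `(exp a - 1) / a`; the contributions of the `-1`
are summed by `sum_inv_sq_prod_erase` and become the rational part of `H`. -/
lemma HFormula_eq {u : ι → ℝ} (h0 : ∀ j, u j ≠ 0) (hu : Function.Injective u) :
    HFormula u = ∫ r in (0 : ℝ)..1, dividedExp (insert 0 (Finset.univ.image u)) r := by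
  set A := Finset.univ.image u with hA
  have h0A : (0 : ℝ) ∉ A := by simpa [hA] using h0
  have hne : ∀ a ∈ A, a ≠ 0 := fun a ha h => h0A (h ▸ ha)
  have hcard : Fintype.card ι = A.card := (Finset.card_image_of_injective _ hu).symm
  have hform : HFormula u = (-1) ^ A.card * ((1 + ∑ a ∈ A, a⁻¹) / ∏ a ∈ A, a) +
      ∑ a ∈ A, Real.exp a / (a ^ 2 * ∏ b ∈ A.erase a, (a - b)) := by
    rw [HFormula, hcard, hA, Finset.sum_image hu.injOn, Finset.prod_image hu.injOn,
      Finset.sum_image hu.injOn]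
    congr 1
    exact Finset.sum_congr rfl fun i _ => by rw [prod_erase_image hu]
  have hint : ∫ r in (0 : ℝ)..1, dividedExp (insert 0 A) r =
      (∏ a ∈ A, (0 - a))⁻¹ + ∑ a ∈ A, (Real.exp a - 1) * (a ^ 2 * ∏ b ∈ A.erase a, (a - b))⁻¹ := by
    have : ∀ r, dividedExp (insert 0 A) r = (∏ a ∈ A, (0 - a))⁻¹ +
        ∑ a ∈ A, (a * ∏ b ∈ A.erase a, (a - b))⁻¹ * Real.exp (a * r) := by
      intro r
      rw [dividedExp, Finset.sum_insert h0A, Finset.erase_insert h0A, mul_zero, Real.exp_zero,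
        one_div]
      congr 1
      refine Finset.sum_congr rfl fun a ha => ?_
      rw [Finset.erase_insert_of_ne (hne a ha).symm,
        Finset.prod_insert (fun h => h0A (Finset.mem_of_mem_erase h)), sub_zero, mul_comm r,
        div_eq_inv_mul]
    simp only [this]
    rw [intervalIntegral.integral_add (by simp)
      ((by fun_prop : Continuous _).intervalIntegrable _ _), intervalIntegral.integral_finsetSum
      (fun a _ => (by fun_prop : Continuous _).intervalIntegrable _ _)]
    congr 1
    · simp
    · refine Finset.sum_congr rfl fun a ha => ?_
      rw [intervalIntegral.integral_const_mul,
        intervalIntegral.integral_comp_mul_left (fun x => Real.exp x) (hne a ha), integral_exp]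
      have := hne a ha
      have := prod_erase_sub_ne_zero A a
      simp only [mul_zero, Real.exp_zero, mul_one, smul_eq_mul]
      field_simp
  rw [hform, hint]
  have e3 : ∏ a ∈ A, ((0 : ℝ) - a) = (-1) ^ A.card * ∏ a ∈ A, a := by
    rw [← Finset.prod_const, ← Finset.prod_mul_distrib]
    exact Finset.prod_congr rfl fun a _ => by ring
  have hs : ∑ a ∈ A, (a ^ 2 * ∏ b ∈ A.erase a, (a - b))⁻¹ =
      -((-1) ^ A.card * ((∑ a ∈ A, a⁻¹) / ∏ a ∈ A, a)) := by
    rcases A.eq_empty_or_nonempty with h | h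
    · simp [h]
    · exact sum_inv_sq_prod_erase h h0A
  have hs2 : ∑ a ∈ A, (Real.exp a - 1) * (a ^ 2 * ∏ b ∈ A.erase a, (a - b))⁻¹ =
      ∑ a ∈ A, Real.exp a / (a ^ 2 * ∏ b ∈ A.erase a, (a - b)) -
        ∑ a ∈ A, (a ^ 2 * ∏ b ∈ A.erase a, (a - b))⁻¹ := by
    rw [← Finset.sum_sub_distrib]
    exact Finset.sum_congr rfl fun a _ => by ring
  rw [hs2, hs, e3, mul_inv, add_div]
  rcases neg_one_pow_eq_or ℝ A.card with h1 | h1 <;> rw [h1] <;> ring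

/-- The complement is a finite union of proper subspaces, hence null. Density is what makes the
values of `extendFrom` determined everywhere. -/
lemma dense_injective_ne_zero :
    Dense {u : ι → ℝ | (∀ j, u j ≠ 0) ∧ Function.Injective u} := by
  have h1 : ∀ j : ι, ∀ᵐ u : ι → ℝ, u j ≠ 0 := fun j => by
    have := Measure.addHaar_submodule (volume : Measure (ι → ℝ))
      (LinearMap.ker (LinearMap.proj (R := ℝ) (φ := fun _ : ι => ℝ) j)) (by
        intro h
        have : Pi.single j (1 : ℝ) ∈ LinearMap.ker (LinearMap.proj (R := ℝ) (φ := fun _ : ι => ℝ) j) :=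
          h ▸ Submodule.mem_top
        simp at this)
    exact (measure_eq_zero_iff_ae_notMem.1 this).mono fun u hu => by simpa using hu
  have h2 : ∀ i j : ι, i ≠ j → ∀ᵐ u : ι → ℝ, u i ≠ u j := fun i j hij => by
    have := Measure.addHaar_submodule (volume : Measure (ι → ℝ))
      (LinearMap.ker (LinearMap.proj (R := ℝ) (φ := fun _ : ι => ℝ) i - LinearMap.proj j)) (by
        intro h
        have : Pi.single j (1 : ℝ) ∈
            LinearMap.ker (LinearMap.proj (R := ℝ) (φ := fun _ : ι => ℝ) i - LinearMap.proj j) :=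
          h ▸ Submodule.mem_top
        simp [hij] at this)
    exact (measure_eq_zero_iff_ae_notMem.1 this).mono fun u hu => by
      simpa [sub_eq_zero] using hu
  refine Measure.dense_of_ae (μ := volume) ?_
  have h3 : ∀ᵐ u : ι → ℝ, ∀ i j : ι, i ≠ j → u i ≠ u j := by
    simp only [ae_all_iff]; exact h2
  filter_upwards [ae_all_iff.2 h1, h3] with u hu1 hu2
  exact ⟨hu1, fun i j h => by_contra fun hij => hu2 i j hij h⟩

/-- `H` as a moment of the exponential over the unit corner simplex. -/
lemma H_eq_cornerMoment {d : ℕ} (e : Fin d ≃ ι) (u : ι → ℝ) :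
    H u = cornerMoment (fun j => u (e j)) := by
  -- A continuous function that agrees with the formula on the dense set is its extension.
  refine extendFrom_eq (dense_injective_ne_zero u) ?_
  have hc : Continuous fun v : ι → ℝ => cornerMoment (fun j => v (e j)) :=
    (continuous_cornerMoment d).comp (by fun_prop)
  refine (hc.continuousWithinAt (s := {u : ι → ℝ | (∀ j, u j ≠ 0) ∧ Function.Injective u})
    (x := u)).tendsto.congr' ?_
  filter_upwards [self_mem_nhdsWithin] with v hv
  rw [cornerMoment_eq_integral, HFormula_eq hv.1 hv.2]
  refine intervalIntegral.integral_congr fun r hr => ?_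
  rw [uIcc_of_le zero_le_one] at hr
  have himg : (Finset.univ.image fun j => v (e j)) = Finset.univ.image v := by
    ext a; simp [e.exists_congr_left]
  rw [cornerIntegral_eq_dividedExp _ (fun j => hv.1 _) (hv.2.comp e.injective) hr.1, himg]

/-- Translating the nodes preserves their differences. This allows one node to be moved to `0`, as
the corner integral requires. -/
lemma dividedExp_image_add (A : Finset ℝ) (c : ℝ) :
    dividedExp (A.image (· + c)) 1 = Real.exp c * dividedExp A 1 := by
  have hc : Function.Injective (· + c) := add_left_injective c
  rw [dividedExp, dividedExp, Finset.sum_image hc.injOn, Finset.mul_sum]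
  refine Finset.sum_congr rfl fun a _ => ?_
  rw [← Finset.image_erase hc, Finset.prod_image hc.injOn, one_mul, one_mul, mul_div_assoc',
    ← Real.exp_add, add_comm]
  congr 1
  exact Finset.prod_congr rfl fun b _ => by ring

/-- `expSum` as an integral of the exponential over the unit corner simplex. -/
lemma expSum_eq_cornerIntegral {d : ℕ} (e : Fin (d + 1) ≃ ι) (z : ι → ℝ) :
    expSum z = Real.exp (z (e 0)) * cornerIntegral (fun j => z (e j.succ) - z (e 0)) 1 := by
  have hd : Dense {z : ι → ℝ | Function.Injective z} :=
    dense_injective_ne_zero.mono fun u hu => hu.2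
  refine extendFrom_eq (hd z) ?_
  have hc : Continuous fun v : ι → ℝ =>
      Real.exp (v (e 0)) * cornerIntegral (fun j => v (e j.succ) - v (e 0)) 1 :=
    (by fun_prop : Continuous fun v : ι → ℝ => Real.exp (v (e 0))).mul
      ((continuous_cornerIntegral d 1).comp (by fun_prop))
  refine (hc.continuousWithinAt (s := {z : ι → ℝ | Function.Injective z})
    (x := z)).tendsto.congr' ?_
  filter_upwards [self_mem_nhdsWithin] with v hv
  have hv : Function.Injective v := hv
  rw [expSumFormula_eq hv, cornerIntegral_eq_dividedExp _ _ _ zero_le_one, ← dividedExp_image_add]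
  · congr 1
    ext a
    simp only [Finset.image_insert, Finset.image_image, Finset.mem_insert, Finset.mem_image,
      Finset.mem_univ, true_and, Function.comp, sub_add_cancel, zero_add]
    rw [← e.exists_congr_right, Fin.exists_fin_succ]
    simp only [eq_comm]
  · exact fun j => sub_ne_zero.2 fun h => absurd (e.injective (hv h)) (Fin.succ_ne_zero j)
  · intro i j h
    exact Fin.succ_injective _ (e.injective (hv (sub_left_injective h)))

lemma continuous_H : Continuous (H : (ι → ℝ) → ℝ) := by
  have e := (Fintype.equivFin ι).symm
  rw [funext (H_eq_cornerMoment e)]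
  exact (continuous_cornerMoment _).comp (by fun_prop)

lemma H_pos (u : ι → ℝ) : 0 < H u := by
  rw [H_eq_cornerMoment (Fintype.equivFin ι).symm]
  exact cornerMoment_pos _

end

/-! ### Full-dimensional simplices of a configuration -/

section Simplex

variable {n d : ℕ} {X : Fin n → Fin d → ℝ} {σ : Finset (Fin n)}

/-- `σ` is the vertex set of a full-dimensional simplex. -/
def IsSimplex (X : Fin n → Fin d → ℝ) (σ : Finset (Fin n)) : Prop :=
  AffineIndependent ℝ (fun i : σ => X i) ∧ affineSpan ℝ (X '' σ) = ⊤

/-- The convex hull of the points with labels in `σ`. -/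
def hull (X : Fin n → Fin d → ℝ) (σ : Finset (Fin n)) : Set (Fin d → ℝ) :=
  convexHull ℝ (X '' (σ : Set (Fin n)))

lemma range_restrict (X : Fin n → Fin d → ℝ) (σ : Finset (Fin n)) :
    range (fun i : σ => X i) = X '' (σ : Set (Fin n)) := by
  rw [image_eq_range]; rfl

/-- The affine basis formed by the vertices of a simplex. -/
def IsSimplex.basis (h : IsSimplex X σ) : AffineBasis σ ℝ (Fin d → ℝ) :=
  ⟨fun i => X i, h.1, by rw [range_restrict]; exact h.2⟩

open Classical in
/-- The barycentric coordinate of label `k` in the simplex `σ`, zero if `k` is not a vertex. -/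
def bary (X : Fin n → Fin d → ℝ) (σ : Finset (Fin n)) (k : Fin n) : (Fin d → ℝ) →ᵃ[ℝ] ℝ :=
  if h : IsSimplex X σ ∧ k ∈ σ then h.1.basis.coord ⟨k, h.2⟩ else 0

/-- The affine interpolant of the heights `z` on the simplex `σ`. -/
def interp (X : Fin n → Fin d → ℝ) (σ : Finset (Fin n)) (z : Fin n → ℝ) : (Fin d → ℝ) →ᵃ[ℝ] ℝ :=
  ∑ k, z k • bary X σ k

lemma interp_apply (X : Fin n → Fin d → ℝ) (σ : Finset (Fin n)) (z : Fin n → ℝ) (t : Fin d → ℝ) :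
    interp X σ z t = ∑ k, z k * bary X σ k t := by
  rw [interp]
  induction (Finset.univ : Finset (Fin n)) using Finset.induction_on with
  | empty => simp
  | insert a s ha ih => rw [Finset.sum_insert ha, Finset.sum_insert ha, ← ih]; rfl

lemma interp_sub_apply (z z' : Fin n → ℝ) (t : Fin d → ℝ) :
    interp X σ (z - z') t = interp X σ z t - interp X σ z' t := by
  simp [interp_apply, sub_mul, Finset.sum_sub_distrib]

lemma bary_of_notMem {k : Fin n} (hk : k ∉ σ) : bary X σ k = 0 := by
  rw [bary, dif_neg (fun h => hk h.2)]

lemma continuous_affineMap (φ : (Fin d → ℝ) →ᵃ[ℝ] ℝ) : Continuous φ :=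
  φ.continuous_of_finiteDimensional

namespace IsSimplex

variable (hσ : IsSimplex X σ)
include hσ

lemma bary_eq (k : σ) : bary X σ k = hσ.basis.coord k := by
  rw [bary, dif_pos ⟨hσ, k.2⟩]

omit hσ in
lemma sum_eq_sum_subtype {M : Type*} [AddCommMonoid M] (g : Fin n → M)
    (hg : ∀ k ∉ σ, g k = 0) : ∑ k, g k = ∑ k : σ, g k := by
  rw [Finset.sum_coe_sort σ g]
  exact (Finset.sum_subset (Finset.subset_univ σ) fun k _ hk => hg k hk).symm

lemma sum_bary (t : Fin d → ℝ) : ∑ k, bary X σ k t = 1 := by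
  rw [sum_eq_sum_subtype _ (fun k hk => by rw [bary_of_notMem hk]; rfl)]
  simp only [hσ.bary_eq]
  exact hσ.basis.sum_coord_apply_eq_one t

lemma sum_bary_smul (t : Fin d → ℝ) : ∑ k, bary X σ k t • X k = t := by
  rw [sum_eq_sum_subtype _ (fun k hk => by rw [bary_of_notMem hk]; simp)]
  simp only [hσ.bary_eq]
  exact hσ.basis.linear_combination_coord_eq_self t

lemma bary_vertex {i : Fin n} (hi : i ∈ σ) (k : Fin n) :
    bary X σ k (X i) = if k = i then 1 else 0 := by
  by_cases hk : k ∈ σ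
  · have := hσ.basis.coord_apply ⟨k, hk⟩ ⟨i, hi⟩
    rw [← hσ.bary_eq ⟨k, hk⟩] at this
    simp only [Subtype.mk.injEq] at this
    exact this
  · have : k ≠ i := fun h => hk (h ▸ hi)
    simp [bary_of_notMem hk, this]

lemma interp_vertex {i : Fin n} (hi : i ∈ σ) (z : Fin n → ℝ) : interp X σ z (X i) = z i := by
  simp [interp_apply, hσ.bary_vertex hi]

lemma eq_interp {φ : (Fin d → ℝ) →ᵃ[ℝ] ℝ} {z : Fin n → ℝ} (h : ∀ i ∈ σ, φ (X i) = z i) :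
    φ = interp X σ z := by
  refine AffineMap.ext_on hσ.2 ?_
  rintro _ ⟨i, hi, rfl⟩
  rw [h i hi, hσ.interp_vertex hi]

lemma range_basis : range hσ.basis = X '' (σ : Set (Fin n)) := range_restrict X σ

lemma mem_hull_iff {t : Fin d → ℝ} : t ∈ hull X σ ↔ ∀ k, 0 ≤ bary X σ k t := by
  rw [hull, ← hσ.range_basis, hσ.basis.convexHull_eq_nonneg_coord]
  constructor
  · intro h k
    by_cases hk : k ∈ σ
    · rw [hσ.bary_eq ⟨k, hk⟩]; exact h ⟨k, hk⟩
    · simp [bary_of_notMem hk]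
  · intro h k
    rw [← hσ.bary_eq k]; exact h k

lemma interior_hull : interior (hull X σ) = {t | ∀ k ∈ σ, 0 < bary X σ k t} := by
  rw [hull, ← hσ.range_basis, hσ.basis.interior_convexHull]
  ext t
  constructor
  · intro h k hk
    rw [hσ.bary_eq ⟨k, hk⟩]; exact h ⟨k, hk⟩
  · intro h k
    rw [← hσ.bary_eq k]; exact h k k.2

lemma interior_hull_nonempty : (interior (hull X σ)).Nonempty :=
  interior_convexHull_nonempty_iff_affineSpan_eq_top.2 hσ.2

lemma card_eq : Fintype.card σ = d + 1 := by
  have := (hσ.1.affineSpan_eq_top_iff_card_eq_finrank_add_one).1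
    (by rw [range_restrict]; exact hσ.2)
  simpa using this

end IsSimplex

lemma isCompact_hull (X : Fin n → Fin d → ℝ) (σ : Finset (Fin n)) : IsCompact (hull X σ) :=
  (σ.finite_toSet.image X).isCompact_convexHull ℝ

lemma convex_hull (X : Fin n → Fin d → ℝ) (σ : Finset (Fin n)) : Convex ℝ (hull X σ) :=
  convex_convexHull ℝ _

lemma measurableSet_hull (X : Fin n → Fin d → ℝ) (σ : Finset (Fin n)) :
    MeasurableSet (hull X σ) := (isCompact_hull X σ).isClosed.measurableSet

lemma hull_subset_polytope (X : Fin n → Fin d → ℝ) (σ : Finset (Fin n)) :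
    hull X σ ⊆ polytope X := convexHull_mono (image_subset_range _ _)

lemma hull_mono {τ : Finset (Fin n)} (h : σ ⊆ τ) : hull X σ ⊆ hull X τ :=
  convexHull_mono (image_mono (by exact_mod_cast h))

/-! ### Integrals over a simplex -/

/-- The linear part of the parametrization of a simplex by the corner simplex. -/
def edgeMap (p : Fin (d + 1) → Fin d → ℝ) : (Fin d → ℝ) →L[ℝ] (Fin d → ℝ) :=
  ∑ j, (ContinuousLinearMap.proj (R := ℝ) (φ := fun _ : Fin d => ℝ) j).smulRight (p j.succ - p 0)

lemma edgeMap_apply (p : Fin (d + 1) → Fin d → ℝ) (s : Fin d → ℝ) :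
    edgeMap p s = ∑ j, s j • (p j.succ - p 0) := by
  simp [edgeMap]

lemma affineMap_edgeMap (p : Fin (d + 1) → Fin d → ℝ) (φ : (Fin d → ℝ) →ᵃ[ℝ] ℝ) (s : Fin d → ℝ) :
    φ (edgeMap p s + p 0) = φ (p 0) + ∑ j, s j * (φ (p j.succ) - φ (p 0)) := by
  have := φ.map_vadd (p 0) (edgeMap p s)
  rw [vadd_eq_add, vadd_eq_add] at this
  rw [this, edgeMap_apply, map_sum, add_comm]
  congr 1
  refine Finset.sum_congr rfl fun j _ => ?_
  rw [map_smul, ← vsub_eq_sub, φ.linearMap_vsub]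
  rfl

variable (e : Fin (d + 1) ≃ σ)

lemma IsSimplex.bary_edgeMap_zero (hσ : IsSimplex X σ) (s : Fin d → ℝ) :
    bary X σ (e 0) (edgeMap (fun j => X (e j)) s + X (e 0)) = 1 - ∑ j, s j := by
  rw [affineMap_edgeMap (fun j => X (e j)), hσ.bary_vertex (e 0).2, if_pos rfl, sub_eq_add_neg,
    ← Finset.sum_neg_distrib]
  congr 1
  refine Finset.sum_congr rfl fun j _ => ?_
  have : (e 0 : Fin n) ≠ e j.succ := fun h =>
    (Fin.succ_ne_zero j) (e.injective (Subtype.ext h)).symm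
  rw [hσ.bary_vertex (e j.succ).2, if_neg this]
  ring

lemma IsSimplex.bary_edgeMap_succ (hσ : IsSimplex X σ) (s : Fin d → ℝ) (i : Fin d) :
    bary X σ (e i.succ) (edgeMap (fun j => X (e j)) s + X (e 0)) = s i := by
  have h0 : (e i.succ : Fin n) ≠ e 0 := fun h =>
    (Fin.succ_ne_zero i) (e.injective (Subtype.ext h))
  rw [affineMap_edgeMap (fun j => X (e j)), hσ.bary_vertex (e 0).2, if_neg h0, zero_add,
    Finset.sum_eq_single i]
  · rw [hσ.bary_vertex (e i.succ).2, if_pos rfl]; ring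
  · intro j _ hj
    have : (e i.succ : Fin n) ≠ e j.succ := fun h =>
      hj (Fin.succ_injective _ (e.injective (Subtype.ext h))).symm
    rw [hσ.bary_vertex (e j.succ).2, if_neg this]; ring
  · simp

/-- The barycentric coordinates of the vertices other than `e 0` invert the parametrization, and the
coordinate at `e 0` is `1 - ∑ s`. -/
lemma IsSimplex.image_cornerSimplex (hσ : IsSimplex X σ) :
    (fun s => edgeMap (fun j => X (e j)) s + X (e 0)) '' cornerSimplex d 1 = hull X σ := by
  ext t
  constructor
  · rintro ⟨s, hs, rfl⟩
    rw [hσ.mem_hull_iff]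
    intro k
    by_cases hk : k ∈ σ
    · obtain ⟨i, hi⟩ := e.surjective ⟨k, hk⟩
      have hk' : k = e i := by rw [hi]
      subst hk'
      induction i using Fin.cases with
      | zero => simp only [hσ.bary_edgeMap_zero]; linarith [hs.2]
      | succ i => simp only [hσ.bary_edgeMap_succ]; exact hs.1 i
    · simp [bary_of_notMem hk]
  · intro ht
    rw [hσ.mem_hull_iff] at ht
    have hsum : ∑ i, bary X σ (e i) t = 1 := by
      rw [← hσ.sum_bary t,
        IsSimplex.sum_eq_sum_subtype (fun k => bary X σ k t) (fun k hk => by rw [bary_of_notMem hk]; rfl)]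
      exact e.sum_comp (fun k : σ => bary X σ k t)
    have hpt : ∑ i, bary X σ (e i) t • X (e i) = t := by
      conv_rhs => rw [← hσ.sum_bary_smul t,
        IsSimplex.sum_eq_sum_subtype _ (fun k hk => by rw [bary_of_notMem hk]; simp)]
      exact e.sum_comp (fun k : σ => bary X σ k t • X k)
    rw [Fin.sum_univ_succ] at hsum hpt
    refine ⟨fun j => bary X σ (e j.succ) t, ⟨fun j => ht _, ?_⟩, ?_⟩
    · linarith [ht (e 0)]
    · conv_rhs => rw [← hpt]
      simp only [edgeMap_apply, smul_sub, Finset.sum_sub_distrib, ← Finset.sum_smul]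
      rw [eq_sub_of_add_eq hsum, sub_smul, one_smul]
      abel

lemma IsSimplex.setIntegral_hull_edgeMap (hσ : IsSimplex X σ) (g : (Fin d → ℝ) → ℝ) :
    ∫ t in hull X σ, g t = |(edgeMap fun j => X (e j)).det| *
      ∫ s in cornerSimplex d 1, g (edgeMap (fun j => X (e j)) s + X (e 0)) := by
  rw [← hσ.image_cornerSimplex e, integral_image_eq_integral_abs_det_fderiv_smul volume
    (measurableSet_cornerSimplex d 1) (f' := fun _ => edgeMap fun j => X (e j))]
  · simp only [smul_eq_mul, integral_const_mul]
  · intro s _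
    exact ((edgeMap fun j => X (e j)).hasFDerivAt.add_const _).hasFDerivWithinAt
  · intro s _ s' _ h
    ext i
    simp only at h
    rw [← hσ.bary_edgeMap_succ e s i, h, hσ.bary_edgeMap_succ]

/-- Change of variables for the constant `1`: the corner simplex has volume `1 / d!`, which cancels
the normalization. -/
lemma IsSimplex.normVol_eq (hσ : IsSimplex X σ) :
    normVol X σ = |(edgeMap fun j => X (e j)).det| := by
  have h := hσ.setIntegral_hull_edgeMap e (fun _ => 1)
  have h2 := cornerIntegral_zero d (zero_le_one (α := ℝ))
  simp only [cornerIntegral, Pi.zero_apply, mul_zero, Finset.sum_const_zero, Real.exp_zero,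
    one_pow] at h2
  have h3 : ∫ t in hull X σ, (1 : ℝ) = (volume (hull X σ)).toReal := by
    simp [Measure.real]
  rw [h2, h3, hull] at h
  rw [normVol, h]
  have : (d.factorial : ℝ) ≠ 0 := by positivity
  field_simp

/-- The integral of the exponential of an affine function over a simplex. -/
lemma IsSimplex.setIntegral_exp_interp (hσ : IsSimplex X σ) (z : Fin n → ℝ) :
    ∫ t in hull X σ, Real.exp (interp X σ z t) = normVol X σ * expSum (fun i : σ => z i) := by
  have e : Fin (d + 1) ≃ σ := (Fintype.equivFinOfCardEq hσ.card_eq).symm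
  rw [hσ.setIntegral_hull_edgeMap e, hσ.normVol_eq e, expSum_eq_cornerIntegral e, cornerIntegral]
  congr 1
  rw [← integral_const_mul]
  simp only [affineMap_edgeMap (fun j => X (e j)), hσ.interp_vertex (e _).2, Real.exp_add]

/-- The weighted integral of the exponential of an affine function over a simplex. -/
lemma IsSimplex.setIntegral_bary_mul_exp_interp (hσ : IsSimplex X σ) (z : Fin n → ℝ) {k : Fin n}
    (hk : k ∈ σ) :
    ∫ t in hull X σ, bary X σ k t * Real.exp (interp X σ z t) =
      normVol X σ * Real.exp (z k) * H (fun i : (σ.erase k : Finset (Fin n)) => z i - z k) := by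
  -- Putting `k` at the origin of the corner simplex turns its barycentric coordinate into the
  -- weight `1 - ∑ s` of `cornerMoment`.
  obtain ⟨e, he⟩ : ∃ e : Fin (d + 1) ≃ σ, (e 0 : Fin n) = k := by
    let e₀ : Fin (d + 1) ≃ σ := (Fintype.equivFinOfCardEq hσ.card_eq).symm
    exact ⟨(Equiv.swap 0 (e₀.symm ⟨k, hk⟩)).trans e₀, by simp⟩
  subst he
  have hne : ∀ j : Fin d, (e j.succ : Fin n) ≠ e 0 := fun j h =>
    (Fin.succ_ne_zero j) (e.injective (Subtype.ext h))
  let f : Fin d → (σ.erase (e 0) : Finset (Fin n)) := fun j =>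
    ⟨e j.succ, Finset.mem_erase.2 ⟨hne j, (e j.succ).2⟩⟩
  have hf : Function.Bijective f := by
    refine (Fintype.bijective_iff_injective_and_card f).2 ⟨fun i j h => ?_, ?_⟩
    · exact Fin.succ_injective _ (e.injective (Subtype.ext
        (congrArg (fun x : (σ.erase _ : Finset (Fin n)) => (x : Fin n)) h)))
    · have := hσ.card_eq
      rw [Fintype.card_coe] at this ⊢
      rw [Finset.card_erase_of_mem hk, this, Fintype.card_fin, Nat.add_sub_cancel]
  rw [hσ.setIntegral_hull_edgeMap e, hσ.normVol_eq e, H_eq_cornerMoment (Equiv.ofBijective f hf),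
    cornerMoment, mul_assoc]
  congr 1
  rw [← integral_const_mul]
  refine integral_congr_ae (Filter.Eventually.of_forall fun s => ?_)
  simp only [affineMap_edgeMap (fun j => X (e j)) (interp X σ z), hσ.interp_vertex (e _).2,
    Real.exp_add]
  rw [hσ.bary_edgeMap_zero]
  simp only [Equiv.ofBijective_apply, f]
  ring

lemma IsSimplex.normVol_pos (hσ : IsSimplex X σ) : 0 < normVol X σ := by
  refine mul_pos (by positivity) (ENNReal.toReal_pos ?_ (isCompact_hull X σ).measure_lt_top.ne)
  exact (Measure.measure_pos_of_nonempty_interior volume hσ.interior_hull_nonempty).ne'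

end Simplex

section Tent

variable {n d : ℕ} {X : Fin n → Fin d → ℝ} {σ : Finset (Fin n)} {z : Fin n → ℝ}
  {t : Fin d → ℝ}

/-! ### The tent function -/

/-- The lifted polytope. -/
def lifted (X : Fin n → Fin d → ℝ) (z : Fin n → ℝ) : Set ((Fin d → ℝ) × ℝ) :=
  convexHull ℝ (range fun i => (X i, z i))

lemma isCompact_lifted (X : Fin n → Fin d → ℝ) (z : Fin n → ℝ) : IsCompact (lifted X z) :=
  (finite_range _).isCompact_convexHull ℝ

lemma image_fst_lifted (X : Fin n → Fin d → ℝ) (z : Fin n → ℝ) :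
    Prod.fst '' lifted X z = polytope X := by
  have := (LinearMap.fst ℝ (Fin d → ℝ) ℝ).image_convexHull (range fun i => (X i, z i))
  rw [← range_comp] at this
  exact this

lemma isCompact_polytope (X : Fin n → Fin d → ℝ) : IsCompact (polytope X) :=
  (finite_range _).isCompact_convexHull ℝ

lemma convex_polytope (X : Fin n → Fin d → ℝ) : Convex ℝ (polytope X) := convex_convexHull ℝ _

lemma mem_polytope (X : Fin n → Fin d → ℝ) (i : Fin n) : X i ∈ polytope X :=
  subset_convexHull ℝ _ (mem_range_self i)

lemma le_tent {r : ℝ} (h : (t, r) ∈ lifted X z) : r ≤ tent X z t := by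
  refine le_csSup ?_ h
  refine ((isCompact_lifted X z).image continuous_snd).bddAbove.mono ?_
  intro s hs
  exact ⟨(t, s), hs, rfl⟩

lemma tent_mem (z : Fin n → ℝ) (ht : t ∈ polytope X) : (t, tent X z t) ∈ lifted X z := by
  have hcl : IsClosed {r : ℝ | (t, r) ∈ lifted X z} :=
    (isCompact_lifted X z).isClosed.preimage (f := fun r : ℝ => (t, r)) (by fun_prop)
  refine hcl.csSup_mem ?_ ?_
  · rw [← image_fst_lifted X z] at ht
    obtain ⟨⟨t', r⟩, hp, rfl⟩ := ht
    exact ⟨r, hp⟩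
  · refine ((isCompact_lifted X z).image continuous_snd).bddAbove.mono ?_
    intro s hs
    exact ⟨(t, s), hs, rfl⟩

lemma le_tent_vertex (X : Fin n → Fin d → ℝ) (z : Fin n → ℝ) (i : Fin n) : z i ≤ tent X z (X i) :=
  le_tent (subset_convexHull ℝ _ (mem_range_self i))

lemma concaveOn_tent (X : Fin n → Fin d → ℝ) (z : Fin n → ℝ) :
    ConcaveOn ℝ (polytope X) (tent X z) := by
  refine ⟨convex_polytope X, fun s hs t ht a b ha hb hab => ?_⟩
  exact le_tent (convex_convexHull ℝ _ (tent_mem z hs) (tent_mem z ht) ha hb hab)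

lemma tent_le {φ : (Fin d → ℝ) →ᵃ[ℝ] ℝ} (h : ∀ i, z i ≤ φ (X i)) (ht : t ∈ polytope X) :
    tent X z t ≤ φ t := by
  have hconv : Convex ℝ {p : (Fin d → ℝ) × ℝ | p.2 ≤ φ p.1} := by
    intro p hp q hq a b ha hb hab
    simp only [mem_ofPred_eq] at hp hq ⊢
    rw [Prod.fst_add, Prod.smul_fst, Prod.smul_fst, Convex.combo_affine_apply hab]
    simp only [Prod.snd_add, Prod.smul_snd, smul_eq_mul]
    gcongr
  exact convexHull_min (by rintro _ ⟨i, rfl⟩; exact h i) hconv (tent_mem z ht)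

lemma le_tent_of_affine {φ : (Fin d → ℝ) →ᵃ[ℝ] ℝ} (h : ∀ i ∈ σ, φ (X i) ≤ z i)
    (ht : t ∈ hull X σ) : φ t ≤ tent X z t := by
  have hconv : Convex ℝ {s : Fin d → ℝ | s ∈ polytope X ∧ φ s ≤ tent X z s} := by
    intro p hp q hq a b ha hb hab
    refine ⟨convex_polytope X hp.1 hq.1 ha hb hab, ?_⟩
    rw [Convex.combo_affine_apply hab]
    refine le_trans ?_ ((concaveOn_tent X z).2 hp.1 hq.1 ha hb hab)
    have h1 := hp.2
    have h2 := hq.2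
    simp only [smul_eq_mul]
    gcongr
  refine (convexHull_min ?_ hconv ht).2
  rintro _ ⟨i, hi, rfl⟩
  exact ⟨mem_polytope X i, (h i hi).trans (le_tent_vertex X z i)⟩

lemma lifted_of_weights {c : Fin n → ℝ} (h0 : ∀ k, 0 ≤ c k) (h1 : ∑ k, c k = 1)
    (ht : ∑ k, c k • X k = t) : (t, ∑ k, c k * z k) ∈ lifted X z := by
  refine mem_convexHull_of_exists_fintype c (fun i => (X i, z i)) h0 h1 (fun i => mem_range_self i) ?_
  ext1
  · simp [Prod.fst_sum, ht]
  · simp [Prod.snd_sum]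

/-- First-order optimality of a convex combination representing the value of the tent. -/
lemma sum_mul_nonpos_of_optimal {c v : Fin n → ℝ} (h0 : ∀ k, 0 ≤ c k) (h1 : ∑ k, c k = 1)
    (ht : ∑ k, c k • X k = t) (hz : ∑ k, c k * z k = tent X z t) (hv1 : ∑ k, v k = 0)
    (hvX : ∑ k, v k • X k = 0) (hv0 : ∀ k, c k = 0 → 0 ≤ v k) : ∑ k, v k * z k ≤ 0 := by
  have hev : ∀ᶠ ε : ℝ in nhdsWithin 0 (Ioi 0), ∀ k, 0 ≤ c k + ε * v k := by
    rw [Filter.eventually_all]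
    intro k
    rcases (h0 k).eq_or_lt with h | h
    · filter_upwards [self_mem_nhdsWithin] with ε hε
      rw [← h, zero_add]
      exact mul_nonneg (le_of_lt hε) (hv0 k h.symm)
    · have hc : Filter.Tendsto (fun ε : ℝ => c k + ε * v k) (nhds 0) (nhds (c k + 0 * v k)) :=
        (by fun_prop : Continuous fun ε : ℝ => c k + ε * v k).tendsto 0
      have := hc.eventually (lt_mem_nhds (by simpa using h))
      exact (this.filter_mono nhdsWithin_le_nhds).mono fun ε hε => hε.le
  obtain ⟨ε, hε, hpos⟩ := (hev.and self_mem_nhdsWithin).exists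
  have hpos : 0 < ε := hpos
  have hm := le_tent (lifted_of_weights (X := X) (z := z) (t := t) hε
    (by rw [Finset.sum_add_distrib, ← Finset.mul_sum, h1, hv1]; simp)
    (by simp only [add_smul, mul_smul, Finset.sum_add_distrib, ← Finset.smul_sum, ht, hvX]; simp))
  simp only [add_mul, mul_assoc, Finset.sum_add_distrib, ← Finset.mul_sum, hz] at hm
  by_contra hcon
  push Not at hcon
  have := mul_pos hpos hcon
  linarith

/-! ### Simplices supporting a height function -/

/-- Dependencies are expressed as weights on all labels, so that subsets of different sizes can be
compared without subtypes. -/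
lemma affineIndependent_restrict_iff {E : Type*} [AddCommGroup E] [Module ℝ E] {q : Fin n → E} :
    AffineIndependent ℝ (fun i : σ => q i) ↔
      ∀ v : Fin n → ℝ, (∀ k ∉ σ, v k = 0) → ∑ k, v k = 0 → ∑ k, v k • q k = 0 → v = 0 := by
  rw [affineIndependent_iff]
  constructor
  · intro h v hv h1 hq
    rw [IsSimplex.sum_eq_sum_subtype _ hv] at h1
    rw [IsSimplex.sum_eq_sum_subtype _ (fun k hk => by rw [hv k hk, zero_smul])] at hq
    ext k
    by_cases hk : k ∈ σ
    · exact h Finset.univ (fun i => v i) h1 hq ⟨k, hk⟩ (Finset.mem_univ _)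
    · exact hv k hk
  · intro h s w h1 hq i hi
    have key := h (fun k => if hk : k ∈ σ then (if (⟨k, hk⟩ : σ) ∈ s then w ⟨k, hk⟩ else 0) else 0)
      (fun k hk => dif_neg hk)
      (by
        rw [IsSimplex.sum_eq_sum_subtype (σ := σ) _ (fun k hk => dif_neg hk)]
        simpa [Finset.inter_eq_right.2 (fun i _ => Finset.mem_attach σ i)] using h1)
      (by
        rw [IsSimplex.sum_eq_sum_subtype (σ := σ) _ (fun k hk => by rw [dif_neg hk, zero_smul])]
        simpa [ite_smul, Finset.inter_eq_right.2 (fun i _ => Finset.mem_attach σ i)] using hq)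
    have := congrFun key i
    simpa [hi] using this

/-- Carathéodory's theorem with the weights carried back to labels; summing over the fibres of `f`
avoids having to prove `f` injective. -/
lemma exists_pos_weights {E : Type*} [AddCommGroup E] [Module ℝ E] {q : Fin n → E} {p : E}
    (hp : p ∈ convexHull ℝ (range q)) :
    ∃ (σ : Finset (Fin n)) (c : Fin n → ℝ), AffineIndependent ℝ (fun i : σ => q i) ∧
      (∀ k ∈ σ, 0 < c k) ∧ (∀ k ∉ σ, c k = 0) ∧ ∑ k, c k = 1 ∧ ∑ k, c k • q k = p := by
  obtain ⟨ι, _, x, w, hx, hind, hw, hw1, hwx⟩ := eq_pos_convex_span_of_mem_convexHull hp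
  choose f hf using fun i => hx (mem_range_self i)
  classical
  let σ := Finset.univ.image f
  let c : Fin n → ℝ := fun k => ∑ i, if f i = k then w i else 0
  refine ⟨σ, c, ?_, ?_, ?_, ?_, ?_⟩
  · have hg : ∀ k : σ, ∃ i, f i = k := fun k => by
      obtain ⟨i, _, hi⟩ := Finset.mem_image.1 k.2
      exact ⟨i, hi⟩
    choose g hg using hg
    have hgi : Function.Injective g := fun a b h => Subtype.ext (by rw [← hg a, ← hg b, h])
    have := hind.comp_embedding ⟨g, hgi⟩
    have hfun : (fun i : σ => q i) = x ∘ g := by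
      funext k
      rw [Function.comp, ← hf, hg]
    rw [hfun]
    exact this
  · intro k hk
    obtain ⟨i, _, hi⟩ := Finset.mem_image.1 hk
    refine Finset.sum_pos' (fun j _ => ?_) ⟨i, Finset.mem_univ _, by simp [hi, hw]⟩
    split_ifs
    exacts [(hw j).le, le_rfl]
  · intro k hk
    refine Finset.sum_eq_zero fun i _ => if_neg fun h => hk ?_
    exact Finset.mem_image.2 ⟨i, Finset.mem_univ _, h⟩
  · rw [Finset.sum_comm]
    simpa using hw1
  · simp only [c, Finset.sum_smul, ite_smul, zero_smul]
    rw [Finset.sum_comm]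
    simpa [hf] using hwx

/-- `t` avoids the affine spans of all non-spanning subsets of the configuration. -/
def IsGenericPoint (X : Fin n → Fin d → ℝ) (t : Fin d → ℝ) : Prop :=
  ∀ S : Finset (Fin n), affineSpan ℝ (X '' (S : Set (Fin n))) ≠ ⊤ →
    t ∉ affineSpan ℝ (X '' (S : Set (Fin n)))

lemma dense_isGenericPoint (X : Fin n → Fin d → ℝ) : Dense {t | IsGenericPoint X t} := by
  refine Measure.dense_of_ae (μ := volume) ?_
  unfold IsGenericPoint
  rw [ae_all_iff]
  intro S
  by_cases h : affineSpan ℝ (X '' (S : Set (Fin n))) = ⊤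
  · exact Filter.Eventually.of_forall fun t ht => absurd h ht
  · have := Measure.addHaar_affineSubspace (volume : Measure (Fin d → ℝ)) _ h
    exact (measure_eq_zero_iff_ae_notMem.1 this).mono fun t ht _ => ht

/-- The interpolant of `z` on the simplex `σ` dominates `z`. -/
def Supports (X : Fin n → Fin d → ℝ) (σ : Finset (Fin n)) (z : Fin n → ℝ) : Prop :=
  IsSimplex X σ ∧ ∀ j, z j ≤ interp X σ z (X j)

/-- Carathéodory at the top lifted point over `t` gives a label set with positive weights.
Maximality of the height forces its projection to be affinely independent and its interpolant to
dominate `z`; genericity of `t` forces it to be full-dimensional. -/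
lemma exists_supports (z : Fin n → ℝ) (ht : t ∈ polytope X) (hgen : IsGenericPoint X t) :
    ∃ σ, Supports X σ z ∧ t ∈ interior (hull X σ) := by
  obtain ⟨σ, c, hind, hpos, hzero, hc1, hcp⟩ := exists_pos_weights (tent_mem z ht)
  have hcX : ∑ k, c k • X k = t := by
    simpa [Prod.fst_sum] using congrArg Prod.fst hcp
  have hcz : ∑ k, c k * z k = tent X z t := by
    simpa [Prod.snd_sum] using congrArg Prod.snd hcp
  have hc0 : ∀ k, 0 ≤ c k := fun k => by
    by_cases hk : k ∈ σ
    exacts [(hpos k hk).le, (hzero k hk).ge]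
  have hnz : ∀ k, c k = 0 → k ∉ σ := fun k h hk => (hpos k hk).ne' h
  have hindX : AffineIndependent ℝ (fun i : σ => X i) := by
    rw [affineIndependent_restrict_iff]
    intro v hv h1 hX
    refine affineIndependent_restrict_iff (q := fun i => (X i, z i)).1 hind v hv h1 ?_
    -- Both `v` and `-v` are admissible perturbations, so a dependency of the base points is one of
    -- the lifted points as well.
    have hle := sum_mul_nonpos_of_optimal hc0 hc1 hcX hcz h1 hX
      (fun k hk => (hv k (hnz k hk)).ge)
    have hge := sum_mul_nonpos_of_optimal (v := -v) hc0 hc1 hcX hcz (by simp [h1]) (by simp [hX])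
      (fun k hk => by simp [hv k (hnz k hk)])
    simp only [Pi.neg_apply, neg_mul, Finset.sum_neg_distrib] at hge
    ext1
    · simpa [Prod.fst_sum] using hX
    · simp only [Prod.snd_sum, Prod.smul_snd, smul_eq_mul, Prod.snd_zero]
      linarith
  have hmem : t ∈ hull X σ := by
    have : ∑ k ∈ σ, c k • X k = t := by
      rw [← hcX]
      exact Finset.sum_subset (Finset.subset_univ σ) fun k _ hk => by rw [hzero k hk, zero_smul]
    rw [← this]
    refine (convex_hull X σ).sum_mem (fun k _ => hc0 k) ?_
      (fun k hk => subset_convexHull ℝ _ (mem_image_of_mem X hk))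
    rw [← hc1]
    exact Finset.sum_subset (Finset.subset_univ σ) fun k _ hk => hzero k hk
  have hσ : IsSimplex X σ := by
    refine ⟨hindX, by_contra fun h => hgen σ h (convexHull_subset_affineSpan _ hmem)⟩
  have hbary : ∀ k, bary X σ k t = c k := by
    have := affineIndependent_restrict_iff.1 hindX (fun k => bary X σ k t - c k)
      (fun k hk => by simp [bary_of_notMem hk, hzero k hk])
      (by rw [Finset.sum_sub_distrib, hσ.sum_bary, hc1, sub_self])
      (by simp only [sub_smul, Finset.sum_sub_distrib, hσ.sum_bary_smul, hcX, sub_self])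
    exact fun k => sub_eq_zero.1 (congrFun this k)
  refine ⟨σ, ⟨hσ, fun j => ?_⟩, ?_⟩
  -- Shift mass to the label `j` from the vertices of `σ`, in the proportions that represent `X j`.
  · have := sum_mul_nonpos_of_optimal (v := fun k => (if k = j then 1 else 0) - bary X σ k (X j))
      hc0 hc1 hcX hcz (by rw [Finset.sum_sub_distrib, hσ.sum_bary]; simp)
      (by simp [sub_smul, Finset.sum_sub_distrib, hσ.sum_bary_smul])
      (fun k hk => by rw [bary_of_notMem (hnz k hk)]; simp; split_ifs <;> norm_num)
    simp only [sub_mul, Finset.sum_sub_distrib, ite_mul, one_mul, zero_mul, Finset.sum_ite_eq',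
      Finset.mem_univ, if_true] at this
    rw [interp_apply]
    simp only [mul_comm (z _)]
    linarith
  · rw [hσ.interior_hull]
    intro k hk
    rw [hbary]
    exact hpos k hk

lemma Supports.tent_le (h : Supports X σ z) (ht : t ∈ polytope X) : tent X z t ≤ interp X σ z t :=
  LogConcaveMLE.tent_le h.2 ht

lemma IsSimplex.interp_le_tent (h : IsSimplex X σ) (z : Fin n → ℝ) (ht : t ∈ hull X σ) :
    interp X σ z t ≤ tent X z t :=
  le_tent_of_affine (fun _ hi => (h.interp_vertex hi z).le) ht

lemma Supports.tent_eq (h : Supports X σ z) (ht : t ∈ hull X σ) : tent X z t = interp X σ z t :=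
  (h.tent_le (hull_subset_polytope X σ ht)).antisymm (h.1.interp_le_tent z ht)

/-! ### Cells and regular triangulations -/

/-- This trades regions of linearity for supporting simplices. A generic interior point of a region
lies in the interior of such a simplex, whose interpolant agrees with the affine function of the
region on an open set. -/
lemma mem_subdivision_iff {C : Finset (Fin n)} :
    C ∈ subdivision X z ↔ ∃ σ, Supports X σ z ∧ ∀ i, i ∈ C ↔ z i = interp X σ z (X i) := by
  have key : ∀ {σ}, Supports X σ z → ∀ i,
      (X i ∈ {t | t ∈ polytope X ∧ tent X z t = interp X σ z t} ∧ tent X z (X i) = z i) ↔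
        z i = interp X σ z (X i) := by
    intro σ hσ i
    constructor
    · rintro ⟨⟨_, h1⟩, h2⟩
      rw [← h2, h1]
    · intro h
      have h1 := hσ.tent_le (mem_polytope X i)
      have h2 := le_tent_vertex X z i
      exact ⟨⟨mem_polytope X i, by linarith⟩, by linarith⟩
  constructor
  · rintro ⟨R, ⟨ℓ, rfl, hint⟩, hC⟩
    obtain ⟨t, htR, htg⟩ := (dense_isGenericPoint X).inter_open_nonempty _ isOpen_interior hint
    obtain ⟨σ, hσ, htσ⟩ := exists_supports z (interior_subset htR).1 htg
    have hℓ : ℓ = interp X σ z := by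
      refine AffineMap.ext_on ((isOpen_interior.inter isOpen_interior).affineSpan_eq_top
        ⟨t, htR, htσ⟩) ?_
      rintro s ⟨hs1, hs2⟩
      rw [← (interior_subset hs1).2, hσ.tent_eq (interior_subset hs2)]
    subst hℓ
    exact ⟨σ, hσ, fun i => (hC i).trans (key hσ i)⟩
  · rintro ⟨σ, hσ, hC⟩
    refine ⟨_, ⟨interp X σ z, rfl, ?_⟩, fun i => (hC i).trans (key hσ i).symm⟩
    exact hσ.1.interior_hull_nonempty.mono (interior_mono fun t ht =>
      ⟨hull_subset_polytope X σ ht, hσ.tent_eq ht⟩)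

lemma Supports.exists_cell (h : Supports X σ z) : ∃ C ∈ subdivision X z, σ ⊆ C := by
  classical
  refine ⟨Finset.univ.filter fun i => z i = interp X σ z (X i),
    mem_subdivision_iff.2 ⟨σ, h, fun i => by simp⟩, fun i hi => ?_⟩
  simp [h.1.interp_vertex hi]

/-- `Δ` is a regular triangulation with heights `u`. -/
def IsTriangulationOf (X : Fin n → Fin d → ℝ) (u : Fin n → ℝ) (Δ : Finset (Finset (Fin n))) :
    Prop :=
  (Δ : Set (Finset (Fin n))) = subdivision X u ∧
    ∀ σ ∈ Δ, AffineIndependent ℝ (fun i : σ => X i)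

variable {Δ : Finset (Finset (Fin n))} {u : Fin n → ℝ}

/-- A cell contains a supporting simplex, hence spans; being affinely independent, it is a simplex
with the same interpolant. By the second part, cells with equal interpolants coincide. -/
lemma IsTriangulationOf.supports (h : IsTriangulationOf X u Δ) (hσ : σ ∈ Δ) :
    Supports X σ u ∧ ∀ i, i ∈ σ ↔ u i = interp X σ u (X i) := by
  have hσ' : σ ∈ subdivision X u := h.1 ▸ hσ
  obtain ⟨τ, hτ, hC⟩ := mem_subdivision_iff.1 hσ'
  have hsub : τ ⊆ σ := fun i hi => (hC i).2 (hτ.1.interp_vertex hi u).symm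
  have hs : IsSimplex X σ := by
    refine ⟨h.2 σ hσ, top_le_iff.1 ?_⟩
    rw [← hτ.1.2]
    exact affineSpan_mono ℝ (image_mono (by exact_mod_cast hsub))
  have heq : interp X σ u = interp X τ u :=
    hτ.1.eq_interp fun i hi => hs.interp_vertex (hsub hi) u
  rw [Supports, heq]
  exact ⟨⟨hs, hτ.2⟩, hC⟩

lemma IsRegularTriangulation.isSimplex (h : IsRegularTriangulation X Δ) (hσ : σ ∈ Δ) :
    IsSimplex X σ := by
  obtain ⟨⟨u, hu⟩, hi⟩ := h
  exact (IsTriangulationOf.supports ⟨hu, hi⟩ hσ).1.1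

/-- Refinement becomes finitely many weak linear inequalities in `z`, the description of the closed
secondary cone. -/
lemma refines_iff (h : IsRegularTriangulation X Δ) :
    Refines X Δ z ↔ ∀ σ ∈ Δ, Supports X σ z := by
  refine forall₂_congr fun σ hσ => ⟨?_, fun hs => hs.exists_cell⟩
  rintro ⟨C, hC, hsub⟩
  obtain ⟨τ, hτ, hτC⟩ := mem_subdivision_iff.1 hC
  have hs := h.isSimplex hσ
  have heq : interp X τ z = interp X σ z :=
    hs.eq_interp fun i hi => ((hτC i).1 (hsub hi)).symm
  exact ⟨hs, heq ▸ hτ.2⟩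

lemma interior_polytope_nonempty (hdim : affineSpan ℝ (range X) = ⊤) :
    (interior (polytope X)).Nonempty :=
  interior_convexHull_nonempty_iff_affineSpan_eq_top.2 hdim

/-- The union is closed and contains all generic points of the interior, which are dense there. -/
lemma IsRegularTriangulation.iUnion_hull (h : IsRegularTriangulation X Δ)
    (hdim : affineSpan ℝ (range X) = ⊤) : ⋃ σ : Δ, hull X σ = polytope X := by
  refine (iUnion_subset fun σ : Δ => hull_subset_polytope X σ).antisymm ?_
  have hcl : IsClosed (⋃ σ : Δ, hull X σ) :=
    isClosed_iUnion_of_finite fun σ => (isCompact_hull X σ).isClosed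
  have hP : polytope X = closure (interior (polytope X)) := by
    rw [(convex_polytope X).closure_interior_eq_closure_of_nonempty_interior
      (interior_polytope_nonempty hdim), (isCompact_polytope X).isClosed.closure_eq]
  rw [hP]
  refine closure_minimal (((dense_isGenericPoint X).open_subset_closure_inter
    isOpen_interior).trans (closure_minimal ?_ hcl)) hcl
  rintro t ⟨ht, hgen⟩
  obtain ⟨⟨u, hu⟩, -⟩ := h
  obtain ⟨σ, hσ, htσ⟩ := exists_supports u (interior_subset ht) hgen
  obtain ⟨C, hC, hsub⟩ := hσ.exists_cell
  rw [← hu] at hC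
  exact mem_iUnion.2 ⟨⟨C, hC⟩, hull_mono hsub (interior_subset htσ)⟩

/-- If two simplices overlapped in an open set, both interpolants would equal the tent there, and
the cells would coincide. Otherwise the closed convex intersection is its own frontier, hence null.
-/
lemma IsRegularTriangulation.aedisjoint (h : IsRegularTriangulation X Δ) :
    Pairwise (Function.onFun (AEDisjoint volume) fun σ : Δ => hull X σ) := by
  rintro ⟨σ, hσ⟩ ⟨τ, hτ⟩ hne
  obtain ⟨⟨u, hu⟩, hi⟩ := h
  obtain ⟨hσs, hσi⟩ := IsTriangulationOf.supports ⟨hu, hi⟩ hσ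
  obtain ⟨hτs, hτi⟩ := IsTriangulationOf.supports ⟨hu, hi⟩ hτ
  have hneq : interp X σ u ≠ interp X τ u := fun heq =>
    hne (Subtype.ext (Finset.ext fun i => by rw [hσi, hτi, heq]))
  have hconv : Convex ℝ (hull X σ ∩ hull X τ) := (convex_hull X σ).inter (convex_hull X τ)
  have hclosed : IsClosed (hull X σ ∩ hull X τ) :=
    (isCompact_hull X σ).isClosed.inter (isCompact_hull X τ).isClosed
  have hint : interior (hull X σ ∩ hull X τ) = ∅ := by
    by_contra hcon
    refine hneq (AffineMap.ext_on (isOpen_interior.affineSpan_eq_top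
      (nonempty_iff_ne_empty.2 hcon)) fun s hs => ?_)
    have hs' := interior_subset hs
    rw [← hσs.tent_eq hs'.1, hτs.tent_eq hs'.2]
  have := hconv.addHaar_frontier volume
  rwa [hclosed.frontier_eq, hint, sdiff_empty] at this

end Tent

section Triangulations

variable {n d : ℕ} {X : Fin n → Fin d → ℝ} {σ : Finset (Fin n)} {Δ : Finset (Finset (Fin n))}
  {y z : Fin n → ℝ}

/-! ### Existence of refining triangulations -/

lemma sum_mul_affineMap_eq_zero {v : Fin n → ℝ} (h1 : ∑ k, v k = 0) (hX : ∑ k, v k • X k = 0)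
    (φ : (Fin d → ℝ) →ᵃ[ℝ] ℝ) : ∑ k, v k * φ (X k) = 0 := by
  have hφ : ∀ x, φ x = φ.linear x + φ 0 := fun x => congrFun φ.decomp x
  have : ∑ k, v k * φ (X k) = φ.linear (∑ k, v k • X k) + (∑ k, v k) * φ 0 := by
    rw [map_sum, Finset.sum_mul, ← Finset.sum_add_distrib]
    refine Finset.sum_congr rfl fun k _ => ?_
    rw [hφ (X k), map_smul, smul_eq_mul, mul_add]
  rw [this, hX, h1]
  simp

/-- For almost every `u`, no affinely dependent label set has heights given by an affine function,
since each affine dependency confines such `u` to a hyperplane. -/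
lemma dense_isTriangulationOf (X : Fin n → Fin d → ℝ) :
    Dense {u | ∃ Δ, IsTriangulationOf X u Δ} := by
  have h : ∀ᵐ u : Fin n → ℝ, ∀ S : Finset (Fin n), ¬ AffineIndependent ℝ (fun i : S => X i) →
      ¬ ∃ φ : (Fin d → ℝ) →ᵃ[ℝ] ℝ, ∀ i ∈ S, u i = φ (X i) := by
    rw [ae_all_iff]
    intro S
    by_cases hS : AffineIndependent ℝ (fun i : S => X i)
    · exact Filter.Eventually.of_forall fun u h => absurd hS h
    rw [affineIndependent_restrict_iff] at hS
    push Not at hS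
    obtain ⟨v, hv0, hv1, hvX, hv⟩ := hS
    let L : (Fin n → ℝ) →ₗ[ℝ] ℝ := ∑ k, v k • LinearMap.proj k
    have hL : ∀ u, L u = ∑ k, v k * u k := fun u => by simp [L]
    have hker : LinearMap.ker L ≠ ⊤ := by
      intro htop
      obtain ⟨k, hk⟩ := Function.ne_iff.1 hv
      have : Pi.single k (1 : ℝ) ∈ LinearMap.ker L := htop ▸ Submodule.mem_top
      rw [LinearMap.mem_ker, hL] at this
      simp [Pi.single_apply] at this
      exact hk this
    refine (measure_eq_zero_iff_ae_notMem.1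
      (Measure.addHaar_submodule (volume : Measure (Fin n → ℝ)) _ hker)).mono ?_
    rintro u hu - ⟨φ, hφ⟩
    refine hu ?_
    change L u = 0
    rw [hL, ← sum_mul_affineMap_eq_zero hv1 hvX φ]
    refine Finset.sum_congr rfl fun k _ => ?_
    by_cases hk : k ∈ S
    · rw [hφ k hk]
    · rw [hv0 k hk, zero_mul, zero_mul]
  refine (Measure.dense_of_ae h).mono fun u hu => ?_
  refine ⟨(toFinite (subdivision X u)).toFinset, by simp, fun σ hσ => ?_⟩
  rw [Finite.mem_toFinset] at hσ
  obtain ⟨τ, hτ, hC⟩ := mem_subdivision_iff.1 hσ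
  by_contra hcon
  exact hu σ hcon ⟨interp X τ u, fun i hi => (hC i).1 hi⟩

lemma isClosed_setOf_supports (hΔ : ∀ σ ∈ Δ, IsSimplex X σ) :
    IsClosed {z | ∀ σ ∈ Δ, Supports X σ z} := by
  have : {z | ∀ σ ∈ Δ, Supports X σ z} =
      ⋂ σ ∈ Δ, ⋂ j, {z : Fin n → ℝ | z j ≤ ∑ k, z k * bary X σ k (X j)} := by
    ext z
    simp only [mem_ofPred_eq, mem_iInter, Supports, interp_apply]
    exact forall₂_congr fun σ hσ => and_iff_right (hΔ σ hσ)
  rw [this]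
  exact isClosed_biInter fun σ _ => isClosed_iInter fun j =>
    isClosed_le (by fun_prop) (by fun_prop)

/-- A sequence of heights has a subsequence refined by a single triangulation, which then refines
the limit as well. -/
lemma exists_frequently_refining {zs : ℕ → Fin n → ℝ}
    (hzs : ∀ k, (refiningTriangulations X (zs k)).Nonempty)
    (hlim : Filter.Tendsto zs Filter.atTop (nhds z)) :
    ∃ Δ ∈ refiningTriangulations X z,
      ∃ᶠ k in Filter.atTop, Δ ∈ refiningTriangulations X (zs k) := by
  choose D hD using hzs
  -- Pigeonhole: there are only finitely many families of label sets.
  obtain ⟨Δ, hΔ⟩ : ∃ Δ, ∃ᶠ k in Filter.atTop, D k = Δ := by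
    by_contra hcon
    push Not at hcon
    have := Filter.eventually_all.2 hcon
    obtain ⟨k, hk⟩ := this.exists
    exact hk (D k) rfl
  have hfreq : ∃ᶠ k in Filter.atTop, Δ ∈ refiningTriangulations X (zs k) :=
    hΔ.mono fun k hk => hk ▸ hD k
  obtain ⟨k, hk⟩ := hfreq.exists
  have hcl := isClosed_setOf_supports (X := X) (Δ := Δ) fun σ hσ => hk.1.isSimplex hσ
  refine ⟨Δ, ⟨hk.1, (refines_iff hk.1).2 ?_⟩, hfreq⟩
  exact hcl.mem_of_frequently_of_tendsto
    (hfreq.mono fun j hj => (refines_iff hj.1).1 hj.2) hlim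

/-- Approximate `z` by generic heights, whose own subdivisions are triangulations; one of these
occurs infinitely often and survives in the limit. -/
lemma refiningTriangulations_nonempty (X : Fin n → Fin d → ℝ) (z : Fin n → ℝ) :
    (refiningTriangulations X z).Nonempty := by
  obtain ⟨us, hus, hlim⟩ := mem_closure_iff_seq_limit.1 (dense_isTriangulationOf X z)
  obtain ⟨Δ, hΔ, -⟩ := exists_frequently_refining (X := X) (zs := us) (fun k => by
    obtain ⟨Δ, hΔ⟩ := hus k
    have hreg : IsRegularTriangulation X Δ := ⟨⟨us k, hΔ.1⟩, hΔ.2⟩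
    exact ⟨Δ, hreg, (refines_iff hreg).2 fun σ hσ => (hΔ.supports hσ).1⟩) hlim
  exact ⟨Δ, hΔ⟩

lemma supports_of_mem (h : Δ ∈ refiningTriangulations X z) (hσ : σ ∈ Δ) : Supports X σ z :=
  (refines_iff h.1).1 h.2 σ hσ

/-! ### Integrals of the tent function -/

lemma continuousOn_tent (hdim : affineSpan ℝ (range X) = ⊤) (z : Fin n → ℝ) :
    ContinuousOn (tent X z) (polytope X) := by
  obtain ⟨Δ, hΔ⟩ := refiningTriangulations_nonempty X z
  rw [← hΔ.1.iUnion_hull hdim]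
  refine (locallyFinite_of_finite _).continuousOn_iUnion
    (fun σ : Δ => (isCompact_hull X σ).isClosed) fun σ => ?_
  exact (continuous_affineMap _).continuousOn.congr fun t ht =>
    (supports_of_mem hΔ σ.2).tent_eq ht

lemma integrableOn_exp_tent (hdim : affineSpan ℝ (range X) = ⊤) (z : Fin n → ℝ) :
    IntegrableOn (fun t => Real.exp (tent X z t)) (polytope X) :=
  (Real.continuous_exp.comp_continuousOn (continuousOn_tent hdim z)).integrableOn_compact
    (isCompact_polytope X)

lemma IsRegularTriangulation.setIntegral_polytope (h : IsRegularTriangulation X Δ)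
    (hdim : affineSpan ℝ (range X) = ⊤) {g : (Fin d → ℝ) → ℝ} (hg : IntegrableOn g (polytope X)) :
    ∫ t in polytope X, g t = ∑ σ ∈ Δ, ∫ t in hull X σ, g t := by
  rw [← h.iUnion_hull hdim] at hg ⊢
  rw [integral_iUnion_ae (fun σ => (measurableSet_hull X _).nullMeasurableSet) h.aedisjoint hg,
    tsum_fintype]
  exact Finset.sum_coe_sort Δ fun σ => ∫ t in hull X σ, g t

lemma tentIntegral_eq_sum (h : IsRegularTriangulation X Δ) (hdim : affineSpan ℝ (range X) = ⊤)
    (z : Fin n → ℝ) :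
    tentIntegral X z = ∑ σ ∈ Δ, ∫ t in hull X σ, Real.exp (tent X z t) :=
  h.setIntegral_polytope hdim (integrableOn_exp_tent hdim z)

lemma tentIntegral_eq_sum_interp (hdim : affineSpan ℝ (range X) = ⊤)
    (h : Δ ∈ refiningTriangulations X z) :
    tentIntegral X z = ∑ σ ∈ Δ, ∫ t in hull X σ, Real.exp (interp X σ z t) := by
  rw [tentIntegral_eq_sum h.1 hdim]
  refine Finset.sum_congr rfl fun σ hσ => setIntegral_congr_fun (measurableSet_hull X σ) ?_
  intro t ht
  simp only [(supports_of_mem h hσ).tent_eq ht]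

/-- The tent is affine on each simplex of a refining triangulation, so the sum is the tent integral
and does not depend on the choice of `Δ`. -/
lemma triangulationObjective_eq (hdim : affineSpan ℝ (range X) = ⊤) (w : Fin n → ℝ)
    (h : Δ ∈ refiningTriangulations X z) :
    triangulationObjective X w (z, Δ) = unconstrainedObjective X w z := by
  rw [triangulationObjective, unconstrainedObjective, tentIntegral_eq_sum_interp hdim h]
  congr 1
  exact Finset.sum_congr rfl fun σ hσ => ((h.1.isSimplex hσ).setIntegral_exp_interp z).symm

lemma tentIntegral_pos (hdim : affineSpan ℝ (range X) = ⊤) (z : Fin n → ℝ) :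
    0 < tentIntegral X z := by
  rw [tentIntegral, setIntegral_pos_iff_support_of_nonneg_ae
    (Filter.Eventually.of_forall fun t => (Real.exp_pos _).le) (integrableOn_exp_tent hdim z)]
  have : Function.support (fun t => Real.exp (tent X z t)) = univ :=
    eq_univ_of_forall fun t => (Real.exp_pos _).ne'
  rw [this, univ_inter]
  exact Measure.measure_pos_of_nonempty_interior volume (interior_polytope_nonempty hdim)

lemma IsSimplex.add_const_interp (h : IsSimplex X σ) (z : Fin n → ℝ) (c : ℝ) (t : Fin d → ℝ) :
    interp X σ (fun k => z k + c) t = interp X σ z t + c := by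
  simp only [interp_apply, add_mul, Finset.sum_add_distrib, ← Finset.mul_sum, h.sum_bary, mul_one]

lemma tentIntegral_add_const (hdim : affineSpan ℝ (range X) = ⊤) (z : Fin n → ℝ) (c : ℝ) :
    tentIntegral X (fun k => z k + c) = Real.exp c * tentIntegral X z := by
  obtain ⟨Δ, hΔ⟩ := refiningTriangulations_nonempty X z
  have hΔ' : Δ ∈ refiningTriangulations X (fun k => z k + c) := by
    refine ⟨hΔ.1, (refines_iff hΔ.1).2 fun σ hσ => ⟨hΔ.1.isSimplex hσ, fun j => ?_⟩⟩
    rw [(hΔ.1.isSimplex hσ).add_const_interp]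
    linarith [(supports_of_mem hΔ hσ).2 j]
  rw [tentIntegral_eq_sum_interp hdim hΔ, tentIntegral_eq_sum_interp hdim hΔ', Finset.mul_sum]
  refine Finset.sum_congr rfl fun σ hσ => ?_
  rw [← integral_const_mul]
  simp only [(hΔ.1.isSimplex hσ).add_const_interp, Real.exp_add, mul_comm]

/-! ### The weight vectors -/

lemma weightVector_eq_sum (h : IsRegularTriangulation X Δ) (z : Fin n → ℝ) (k : Fin n) :
    weightVector X z Δ k =
      ∑ σ ∈ Δ, ∫ t in hull X σ, bary X σ k t * Real.exp (interp X σ z t) := by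
  rw [weightVector, Finset.sum_filter]
  refine Finset.sum_congr rfl fun σ hσ => ?_
  split_ifs with hk
  · rw [(h.isSimplex hσ).setIntegral_bary_mul_exp_interp z hk]
  · simp [bary_of_notMem hk]

lemma integrableOn_hull {g : (Fin d → ℝ) → ℝ} (hg : Continuous g) : IntegrableOn g (hull X σ) :=
  hg.continuousOn.integrableOn_compact (isCompact_hull X σ)

lemma weightVector_dotProduct (h : IsRegularTriangulation X Δ) (z v : Fin n → ℝ) :
    weightVector X z Δ ⬝ᵥ v =
      ∑ σ ∈ Δ, ∫ t in hull X σ, interp X σ v t * Real.exp (interp X σ z t) := by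
  have hc : ∀ σ k, Continuous fun t => v k * (bary X σ k t * Real.exp (interp X σ z t)) :=
    fun σ k => by
      have h1 := continuous_affineMap (bary X σ k)
      have h2 := continuous_affineMap (interp X σ z)
      fun_prop
  simp only [dotProduct, weightVector_eq_sum h, Finset.sum_mul]
  rw [Finset.sum_comm]
  refine Finset.sum_congr rfl fun σ hσ => ?_
  simp only [interp_apply X σ v, Finset.sum_mul, mul_assoc]
  rw [integral_finsetSum _ fun k _ => integrableOn_hull (hc σ k)]
  refine Finset.sum_congr rfl fun k _ => ?_
  rw [integral_const_mul, mul_comm]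

/-- Barycentric coordinates sum to `1`. Hence all weight vectors at `y` have the same total mass,
and the cone can be studied through their convex hull. -/
lemma sum_weightVector (hdim : affineSpan ℝ (range X) = ⊤) (h : Δ ∈ refiningTriangulations X z) :
    ∑ k, weightVector X z Δ k = tentIntegral X z := by
  have h1 := weightVector_dotProduct h.1 z (fun _ => 1)
  simp only [dotProduct, mul_one] at h1
  rw [h1, tentIntegral_eq_sum_interp hdim h]
  refine Finset.sum_congr rfl fun σ hσ => ?_
  simp [interp_apply X σ (fun _ => 1), (h.1.isSimplex hσ).sum_bary]

lemma weightVector_nonneg (h : IsRegularTriangulation X Δ) (z : Fin n → ℝ) (k : Fin n) :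
    0 ≤ weightVector X z Δ k :=
  Finset.sum_nonneg fun _ hσ => mul_nonneg
    (mul_nonneg (h.isSimplex (Finset.mem_filter.1 hσ).1).normVol_pos.le (Real.exp_pos _).le)
    (H_pos _).le

lemma weightVector_pos_iff (h : IsRegularTriangulation X Δ) (z : Fin n → ℝ) (k : Fin n) :
    0 < weightVector X z Δ k ↔ ∃ σ ∈ Δ, k ∈ σ := by
  constructor
  · intro hpos
    by_contra hcon
    push Not at hcon
    rw [weightVector, Finset.filter_false_of_mem hcon, Finset.sum_empty] at hpos
    exact lt_irrefl _ hpos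
  · rintro ⟨σ, hσ, hk⟩
    refine Finset.sum_pos (fun τ hτ => ?_) ⟨σ, Finset.mem_filter.2 ⟨hσ, hk⟩⟩
    exact mul_pos (mul_pos (h.isSimplex (Finset.mem_filter.1 hτ).1).normVol_pos (Real.exp_pos _))
      (H_pos _)

lemma continuous_weightVector (X : Fin n → Fin d → ℝ) (Δ : Finset (Finset (Fin n))) :
    Continuous fun z => weightVector X z Δ := by
  refine continuous_pi fun k => continuous_finsetSum _ fun σ _ => ?_
  exact (by fun_prop : Continuous fun z : Fin n → ℝ => normVol X σ * Real.exp (z k)).mul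
    (continuous_H.comp (by fun_prop))

/-! ### The subgradient inequality -/

/-- The tent of `z` lies above its interpolant on any simplex, whether or not `z` is refined; the
rest is `1 + x ≤ exp x` at `x = interp X σ (z - y) t`. -/
lemma IsSimplex.exp_interp_le (h : IsSimplex X σ) {t : Fin d → ℝ} (ht : t ∈ hull X σ) :
    Real.exp (interp X σ y t) + interp X σ (z - y) t * Real.exp (interp X σ y t) ≤
      Real.exp (tent X z t) ∧
    (interp X σ (z - y) t ≠ 0 →
      Real.exp (interp X σ y t) + interp X σ (z - y) t * Real.exp (interp X σ y t) <
        Real.exp (tent X z t)) := by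
  have h1 : Real.exp (interp X σ y t) * Real.exp (interp X σ (z - y) t) ≤ Real.exp (tent X z t) := by
    rw [← Real.exp_add, interp_sub_apply, add_sub_cancel]
    exact Real.exp_le_exp.2 (h.interp_le_tent z ht)
  have hp := Real.exp_pos (interp X σ y t)
  refine ⟨?_, fun hne => ?_⟩
  · nlinarith [Real.add_one_le_exp (interp X σ (z - y) t)]
  · nlinarith [Real.add_one_lt_exp hne]

lemma IsSimplex.subgradient (h : IsSimplex X σ) (hdim : affineSpan ℝ (range X) = ⊤)
    (y z : Fin n → ℝ) :
    (∫ t in hull X σ, Real.exp (interp X σ y t)) +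
        ∫ t in hull X σ, interp X σ (z - y) t * Real.exp (interp X σ y t) ≤
      ∫ t in hull X σ, Real.exp (tent X z t) ∧
    (∀ k ∈ σ, z k ≠ y k → (∫ t in hull X σ, Real.exp (interp X σ y t)) +
        ∫ t in hull X σ, interp X σ (z - y) t * Real.exp (interp X σ y t) <
      ∫ t in hull X σ, Real.exp (tent X z t)) := by
  have hc1 := continuous_affineMap (interp X σ y)
  have hc2 := continuous_affineMap (interp X σ (z - y))
  have i1 : IntegrableOn (fun t => Real.exp (interp X σ y t)) (hull X σ) :=
    integrableOn_hull (by fun_prop)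
  have i2 : IntegrableOn (fun t => interp X σ (z - y) t * Real.exp (interp X σ y t)) (hull X σ) :=
    integrableOn_hull (by fun_prop)
  have i3 : IntegrableOn (fun t => Real.exp (tent X z t)) (hull X σ) :=
    (integrableOn_exp_tent hdim z).mono_set (hull_subset_polytope X σ)
  have i4 : IntegrableOn (fun t => Real.exp (interp X σ y t) +
      interp X σ (z - y) t * Real.exp (interp X σ y t)) (hull X σ) := i1.add i2
  rw [← integral_add i1 i2]
  refine ⟨setIntegral_mono_on i4 i3 (measurableSet_hull X σ)
    fun t ht => (h.exp_interp_le ht).1, fun k hk hne => ?_⟩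
  rw [← sub_pos, ← integral_sub i3 i4, setIntegral_pos_iff_support_of_nonneg_ae
    ((ae_restrict_mem (measurableSet_hull X σ)).mono fun t ht =>
      sub_nonneg.2 (h.exp_interp_le ht).1) (i3.sub i4)]
  have hO : IsOpen (interior (hull X σ) ∩ {t | interp X σ (z - y) t ≠ 0}) :=
    isOpen_interior.inter (isOpen_ne_fun hc2 continuous_const)
  -- An affine function that vanishes on an open set vanishes at the vertex `k` too.
  have hOne : (interior (hull X σ) ∩ {t | interp X σ (z - y) t ≠ 0}).Nonempty := by
    by_contra hcon
    have hzero : interp X σ (z - y) = 0 := by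
      refine AffineMap.ext_on (isOpen_interior.affineSpan_eq_top h.interior_hull_nonempty) ?_
      intro t ht
      by_contra hne0
      exact hcon ⟨t, ht, hne0⟩
    have := h.interp_vertex hk (z - y)
    rw [hzero] at this
    exact hne (sub_eq_zero.1 this.symm)
  refine (hO.measure_pos volume hOne).trans_le (measure_mono fun t ht => ?_)
  have ht' := interior_subset ht.1
  exact ⟨(sub_pos.2 ((h.exp_interp_le ht').2 ht.2)).ne', ht'⟩

/-- The weight vectors are subgradients of the tent integral. -/
lemma tentIntegral_subgradient (hdim : affineSpan ℝ (range X) = ⊤)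
    (h : Δ ∈ refiningTriangulations X y) (z : Fin n → ℝ) :
    tentIntegral X y + weightVector X y Δ ⬝ᵥ (z - y) ≤ tentIntegral X z ∧
    (∀ σ ∈ Δ, ∀ k ∈ σ, z k ≠ y k →
      tentIntegral X y + weightVector X y Δ ⬝ᵥ (z - y) < tentIntegral X z) := by
  rw [tentIntegral_eq_sum_interp hdim h, weightVector_dotProduct h.1, tentIntegral_eq_sum h.1 hdim,
    ← Finset.sum_add_distrib]
  have hs : ∀ σ ∈ Δ, _ := fun σ hσ => (h.1.isSimplex hσ).subgradient hdim y z
  refine ⟨Finset.sum_le_sum fun σ hσ => (hs σ hσ).1, fun σ hσ k hk hne => ?_⟩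
  exact Finset.sum_lt_sum (fun σ hσ => (hs σ hσ).1) ⟨σ, hσ, (hs σ hσ).2 k hk hne⟩

end Triangulations

section Likelihood

variable {n d : ℕ} {X : Fin n → Fin d → ℝ} {y z w : Fin n → ℝ} {f : (Fin d → ℝ) → ℝ}

/-! ### Log-concave densities -/

lemma elog_of_pos {t : Fin d → ℝ} (h : 0 < f t) : elog f t = (Real.log (f t) : EReal) :=
  ENNReal.log_ofReal_of_pos h

lemma elog_of_nonpos {t : Fin d → ℝ} (h : f t ≤ 0) : elog f t = ⊥ := by
  rw [elog, ENNReal.log_ofReal, if_pos h]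

lemma density_of_mem {t : Fin d → ℝ} (ht : t ∈ polytope X) :
    density X z t = Real.exp (tent X z t) := if_pos ht

lemma density_of_notMem {t : Fin d → ℝ} (ht : t ∉ polytope X) : density X z t = 0 := if_neg ht

lemma elog_density_of_mem {t : Fin d → ℝ} (ht : t ∈ polytope X) :
    elog (density X z) t = (tent X z t : EReal) := by
  rw [elog_of_pos (by rw [density_of_mem ht]; exact Real.exp_pos _), density_of_mem ht,
    Real.log_exp]

lemma density_eq_indicator (X : Fin n → Fin d → ℝ) (z : Fin n → ℝ) :
    density X z = (polytope X).indicator fun t => Real.exp (tent X z t) := by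
  classical
  ext t
  rw [density, indicator_apply]

lemma integral_density (X : Fin n → Fin d → ℝ) (z : Fin n → ℝ) :
    ∫ t, density X z t = tentIntegral X z := by
  rw [density_eq_indicator, integral_indicator (isCompact_polytope X).isClosed.measurableSet,
    tentIntegral]

lemma integrable_density (hdim : affineSpan ℝ (range X) = ⊤) (z : Fin n → ℝ) :
    Integrable (density X z) := by
  rw [density_eq_indicator, integrable_indicator_iff (isCompact_polytope X).isClosed.measurableSet]
  exact integrableOn_exp_tent hdim z

lemma density_nonneg (X : Fin n → Fin d → ℝ) (z : Fin n → ℝ) (t : Fin d → ℝ) :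
    0 ≤ density X z t := by
  by_cases ht : t ∈ polytope X
  · rw [density_of_mem ht]; exact (Real.exp_pos _).le
  · rw [density_of_notMem ht]

lemma isLogConcaveDensity_density (hdim : affineSpan ℝ (range X) = ⊤)
    (h1 : tentIntegral X z = 1) : IsLogConcaveDensity (density X z) := by
  refine ⟨density_nonneg X z, ?_, integrable_density hdim z, by rw [integral_density, h1]⟩
  intro s t a b ha hb hab
  by_cases hs : s ∈ polytope X
  · by_cases ht : t ∈ polytope X
    · rw [elog_density_of_mem hs, elog_density_of_mem ht,
        elog_density_of_mem (convex_polytope X hs ht ha.le hb.le hab)]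
      exact_mod_cast (concaveOn_tent X z).2 hs ht ha.le hb.le hab
    · rw [elog_of_nonpos (density_of_notMem ht).le, EReal.coe_mul_bot_of_pos hb, EReal.add_bot]
      exact bot_le
  · rw [elog_of_nonpos (density_of_notMem hs).le, EReal.coe_mul_bot_of_pos ha, EReal.bot_add]
    exact bot_le

/-- The hypograph of the logarithm of a log-concave density is convex. -/
lemma IsLogConcaveDensity.convex_hypograph (hf : IsLogConcaveDensity f) :
    Convex ℝ {p : (Fin d → ℝ) × ℝ | Real.exp p.2 ≤ f p.1} := by
  rw [convex_iff_forall_pos]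
  intro p hp q hq a b ha hb hab
  simp only [mem_ofPred_eq] at hp hq ⊢
  have hp0 : 0 < f p.1 := (Real.exp_pos _).trans_le hp
  have hq0 : 0 < f q.1 := (Real.exp_pos _).trans_le hq
  have h := hf.2.1 p.1 q.1 a b ha hb hab
  rw [elog_of_pos hp0, elog_of_pos hq0] at h
  have hpos : 0 < f (a • p.1 + b • q.1) := by
    by_contra hcon
    rw [elog_of_nonpos (not_lt.1 hcon), le_bot_iff] at h
    exact EReal.coe_ne_bot (a * Real.log (f p.1) + b * Real.log (f q.1)) (by exact_mod_cast h)
  rw [elog_of_pos hpos] at h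
  have h' : a * Real.log (f p.1) + b * Real.log (f q.1) ≤ Real.log (f (a • p.1 + b • q.1)) := by
    exact_mod_cast h
  rw [← Real.le_log_iff_exp_le hp0] at hp
  rw [← Real.le_log_iff_exp_le hq0] at hq
  change Real.exp (a * p.2 + b * q.2) ≤ f (a • p.1 + b • q.1)
  rw [← Real.le_log_iff_exp_le hpos]
  refine le_trans ?_ h'
  gcongr

/-- The convex hypograph of `log f` contains the lifted points, hence the lifted polytope. -/
lemma IsLogConcaveDensity.density_le (hf : IsLogConcaveDensity f)
    (h : ∀ i, Real.exp (z i) ≤ f (X i)) (t : Fin d → ℝ) : density X z t ≤ f t := by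
  by_cases ht : t ∈ polytope X
  · rw [density_of_mem ht]
    exact convexHull_min (by rintro _ ⟨i, rfl⟩; exact h i) hf.convex_hypograph (tent_mem z ht)
  · rw [density_of_notMem ht]
    exact hf.1 t

/-- A log-concave density that dominates a tent density coincides with it. -/
lemma IsLogConcaveDensity.eq_density (hf : IsLogConcaveDensity f)
    (hdim : affineSpan ℝ (range X) = ⊤) (h1 : tentIntegral X y = 1)
    (hle : ∀ t, density X y t ≤ f t) : f = density X y := by
  have hae : ∀ᵐ t, f t = density X y t := by
    have h0 : ∫ t, (f t - density X y t) = 0 := by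
      rw [integral_sub hf.2.2.1 (integrable_density hdim y), hf.2.2.2, integral_density, h1, sub_self]
    rw [integral_eq_zero_iff_of_nonneg (fun t => sub_nonneg.2 (hle t))
      (hf.2.2.1.sub (integrable_density hdim y))] at h0
    exact h0.mono fun t ht => sub_eq_zero.1 ht
  -- Equality almost everywhere leaves single points free, and `f` need not be continuous.
  -- Log-concavity will spread an excess at one point `t` to a nonempty open set, which is excluded
  -- here.
  have hopen : ∀ O : Set (Fin d → ℝ), IsOpen O → (∀ q ∈ O, density X y q < f q) → O = ∅ := by
    intro O hO hlt
    refine hO.eq_empty_of_measure_zero (μ := volume) (measure_mono_null ?_ hae)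
    intro q hq
    exact (hlt q hq).ne'
  by_contra hne
  obtain ⟨t, ht⟩ := Function.ne_iff.1 hne
  have hlt : density X y t < f t := lt_of_le_of_ne (hle t) (Ne.symm ht)
  have hft : 0 < f t := (density_nonneg X y t).trans_lt hlt
  obtain ⟨s₀, hs₀⟩ := interior_polytope_nonempty hdim
  have hseg : ∀ ε ∈ Ioo (0 : ℝ) 1, ∀ s ∈ polytope X,
      Real.exp ((1 - ε) * Real.log (f t) + ε * tent X y s) ≤ f ((1 - ε) • t + ε • s) := by
    intro ε hε s hs
    have hm1 : (t, Real.log (f t)) ∈ {p : (Fin d → ℝ) × ℝ | Real.exp p.2 ≤ f p.1} :=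
      (Real.exp_log hft).le
    have hm2 : (s, tent X y s) ∈ {p : (Fin d → ℝ) × ℝ | Real.exp p.2 ≤ f p.1} := by
      have := hle s
      rwa [density_of_mem hs] at this
    exact hf.convex_hypograph hm1 hm2 (by linarith [hε.2]) hε.1.le (by ring)
  have hlim : Filter.Tendsto (fun ε : ℝ => (1 - ε) • t + ε • s₀) (nhdsWithin 0 (Ioi 0)) (nhds t) := by
    have : Filter.Tendsto (fun ε : ℝ => (1 - ε) • t + ε • s₀) (nhds 0)
        (nhds ((1 - (0 : ℝ)) • t + (0 : ℝ) • s₀)) :=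
      (by fun_prop : Continuous fun ε : ℝ => (1 - ε) • t + ε • s₀).tendsto 0
    simp only [sub_zero, one_smul, zero_smul, add_zero] at this
    exact this.mono_left nhdsWithin_le_nhds
  have hIoo : Ioo (0 : ℝ) 1 ∈ nhdsWithin (0 : ℝ) (Ioi 0) := Ioo_mem_nhdsGT one_pos
  -- The inverse of the contraction `s ↦ (1 - ε) • t + ε • s`, used to describe its image of the
  -- interior as an open preimage.
  have hinv : ∀ ε ∈ Ioo (0 : ℝ) 1, ∀ q : Fin d → ℝ,
      (1 - ε) • t + ε • (ε⁻¹ • (q - (1 - ε) • t)) = q := by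
    intro ε hε q
    rw [smul_smul, mul_inv_cancel₀ hε.1.ne', one_smul]
    abel
  have hinv' : ∀ ε ∈ Ioo (0 : ℝ) 1, ε⁻¹ • (((1 - ε) • t + ε • s₀) - (1 - ε) • t) = s₀ := by
    intro ε hε
    rw [add_sub_cancel_left, smul_smul, inv_mul_cancel₀ hε.1.ne', one_smul]
  by_cases htP : t ∈ polytope X
  · have hL : tent X y t < Real.log (f t) := by
      rw [density_of_mem htP] at hlt
      exact (Real.lt_log_iff_exp_lt hft).2 hlt
    have hmemP : ∀ ε ∈ Ioo (0 : ℝ) 1, (1 - ε) • t + ε • s₀ ∈ interior (polytope X) :=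
      fun ε hε => (convex_polytope X).combo_self_interior_mem_interior htP hs₀
        (by linarith [hε.2]) hε.1 (by ring)
    have hlim1 : Filter.Tendsto (fun ε : ℝ => tent X y ((1 - ε) • t + ε • s₀))
        (nhdsWithin 0 (Ioi 0)) (nhds (tent X y t)) :=
      (continuousOn_tent hdim y t htP).tendsto.comp (tendsto_nhdsWithin_iff.2
        ⟨hlim, Filter.mem_of_superset hIoo fun ε hε =>
          interior_subset (s := polytope X) (hmemP ε hε)⟩)
    have hlim2 : Filter.Tendsto (fun ε : ℝ => (1 - ε) * Real.log (f t) + ε * tent X y s₀)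
        (nhdsWithin 0 (Ioi 0)) (nhds (Real.log (f t))) := by
      have : Filter.Tendsto (fun ε : ℝ => (1 - ε) * Real.log (f t) + ε * tent X y s₀) (nhds 0)
          (nhds ((1 - (0 : ℝ)) * Real.log (f t) + 0 * tent X y s₀)) :=
        (by fun_prop : Continuous fun ε : ℝ =>
          (1 - ε) * Real.log (f t) + ε * tent X y s₀).tendsto 0
      simp only [sub_zero, one_mul, zero_mul, add_zero] at this
      exact this.mono_left nhdsWithin_le_nhds
    -- As `ε → 0`, the lower bound for `log f` along the segment tends to `log (f t)`, while the
    -- tent tends to its smaller value at `t`.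
    obtain ⟨ε, hεlt, hε⟩ := ((hlim1.eventually_lt hlim2 hL).and hIoo).exists
    have hcs : Continuous fun q : Fin d → ℝ => ε⁻¹ • (q - (1 - ε) • t) := by fun_prop
    have hU : IsOpen (interior (polytope X) ∩
        (fun q => ε⁻¹ • (q - (1 - ε) • t)) ⁻¹' interior (polytope X)) :=
      isOpen_interior.inter (isOpen_interior.preimage hcs)
    have hcont : ContinuousOn (fun q => (1 - ε) * Real.log (f t) +
        ε * tent X y (ε⁻¹ • (q - (1 - ε) • t)) - tent X y q) (interior (polytope X) ∩
          (fun q => ε⁻¹ • (q - (1 - ε) • t)) ⁻¹' interior (polytope X)) := by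
      have c1 : ContinuousOn (fun q => tent X y (ε⁻¹ • (q - (1 - ε) • t)))
          (interior (polytope X) ∩
            (fun q => ε⁻¹ • (q - (1 - ε) • t)) ⁻¹' interior (polytope X)) :=
        (continuousOn_tent hdim y).comp hcs.continuousOn fun q hq => interior_subset hq.2
      have c2 : ContinuousOn (tent X y) (interior (polytope X) ∩
            (fun q => ε⁻¹ • (q - (1 - ε) • t)) ⁻¹' interior (polytope X)) :=
        (continuousOn_tent hdim y).mono fun q hq => interior_subset hq.1
      exact (continuousOn_const.add (continuousOn_const.mul c1)).sub c2
    have hO := hcont.isOpen_inter_preimage hU (isOpen_Ioi (a := (0 : ℝ)))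
    refine (eq_empty_iff_forall_notMem.1 (hopen _ hO ?_)) ((1 - ε) • t + ε • s₀)
      ⟨⟨hmemP ε hε, ?_⟩, ?_⟩
    · rintro q ⟨⟨hq1, hq2⟩, hq3⟩
      have hq3 : 0 < (1 - ε) * Real.log (f t) +
        ε * tent X y (ε⁻¹ • (q - (1 - ε) • t)) - tent X y q := hq3
      have := hseg ε hε _ (interior_subset hq2)
      rw [hinv ε hε] at this
      rw [density_of_mem (interior_subset hq1)]
      exact (Real.exp_lt_exp.2 (by linarith)).trans_le this
    · rw [mem_preimage, hinv' ε hε]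
      exact hs₀
    · rw [mem_preimage, hinv' ε hε, mem_Ioi, sub_pos]
      exact hεlt
  · have hPc : (polytope X)ᶜ ∈ nhds t := (isCompact_polytope X).isClosed.isOpen_compl.mem_nhds htP
    obtain ⟨ε, hεP, hε⟩ := ((hlim.eventually hPc).and hIoo).exists
    have hcs : Continuous fun q : Fin d → ℝ => ε⁻¹ • (q - (1 - ε) • t) := by fun_prop
    have hO : IsOpen ((polytope X)ᶜ ∩
        (fun q => ε⁻¹ • (q - (1 - ε) • t)) ⁻¹' interior (polytope X)) :=
      (isCompact_polytope X).isClosed.isOpen_compl.inter (isOpen_interior.preimage hcs)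
    refine (eq_empty_iff_forall_notMem.1 (hopen _ hO ?_)) ((1 - ε) • t + ε • s₀) ⟨hεP, ?_⟩
    · rintro q ⟨hq1, hq2⟩
      have := hseg ε hε _ (interior_subset hq2)
      rw [hinv ε hε] at this
      rw [density_of_notMem hq1]
      exact (Real.exp_pos _).trans_le this
    · rw [mem_preimage, hinv' ε hε]
      exact hs₀

lemma coe_sum_ereal {ι : Type*} (s : Finset ι) (g : ι → ℝ) :
    ((∑ i ∈ s, g i : ℝ) : EReal) = ∑ i ∈ s, (g i : EReal) := by
  classical
  induction s using Finset.induction_on with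
  | empty => simp
  | insert a s ha ih => rw [Finset.sum_insert ha, Finset.sum_insert ha, EReal.coe_add, ih]

lemma logLikelihood_density (X : Fin n → Fin d → ℝ) (w z : Fin n → ℝ) :
    logLikelihood X w (density X z) = ((∑ i, w i * tent X z (X i) : ℝ) : EReal) := by
  rw [logLikelihood, coe_sum_ereal]
  refine Finset.sum_congr rfl fun i _ => ?_
  rw [elog_density_of_mem (mem_polytope X i), EReal.coe_mul]

lemma logLikelihood_of_pos (h : ∀ i, 0 < f (X i)) :
    logLikelihood X w f = ((w ⬝ᵥ fun i => Real.log (f (X i)) : ℝ) : EReal) := by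
  rw [logLikelihood, dotProduct, coe_sum_ereal]
  refine Finset.sum_congr rfl fun i _ => ?_
  rw [elog_of_pos (h i), EReal.coe_mul]

lemma logLikelihood_of_nonpos {i : Fin n} (hw : 0 < w i) (h : f (X i) ≤ 0) :
    logLikelihood X w f = ⊥ := by
  rw [logLikelihood, ← Finset.add_sum_erase _ _ (Finset.mem_univ i), elog_of_nonpos h,
    EReal.coe_mul_bot_of_pos hw, EReal.bot_add]

end Likelihood

/-! ### Optimality conditions -/

section Optimality

variable {n d : ℕ} {X : Fin n → Fin d → ℝ} {y w : Fin n → ℝ}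

lemma dotProduct_add_const (w z : Fin n → ℝ) (c : ℝ) :
    (w ⬝ᵥ fun k => z k + c) = w ⬝ᵥ z + (∑ i, w i) * c := by
  simp [dotProduct, mul_add, Finset.sum_add_distrib, Finset.sum_mul]

lemma tentIntegral_normalize (hdim : affineSpan ℝ (range X) = ⊤) (z : Fin n → ℝ) :
    tentIntegral X (fun k => z k + -Real.log (tentIntegral X z)) = 1 := by
  have hpos := tentIntegral_pos hdim z
  rw [tentIntegral_add_const hdim, Real.exp_neg, Real.exp_log hpos, inv_mul_cancel₀ hpos.ne']

/-- Vectors in the cone of the weight vectors are scaled subgradients, strictly away from `y`. -/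
lemma subgradient_of_mem_cone (hdim : affineSpan ℝ (range X) = ⊤) (h1 : tentIntegral X y = 1)
    (hw : w ∈ PointedCone.hull ℝ (weightVector X y '' refiningTriangulations X y))
    (z : Fin n → ℝ) :
    (∀ k, 0 ≤ w k) ∧ w ⬝ᵥ (z - y) ≤ (∑ k, w k) * (tentIntegral X z - 1) ∧
      ∀ k, z k ≠ y k → 0 < w k → w ⬝ᵥ (z - y) < (∑ k, w k) * (tentIntegral X z - 1) := by
  induction hw using Submodule.span_induction with
  | mem w hw =>
    obtain ⟨Δ, hΔ, rfl⟩ := hw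
    have hs := tentIntegral_subgradient hdim hΔ z
    rw [sum_weightVector hdim hΔ, h1, one_mul]
    rw [h1] at hs
    refine ⟨weightVector_nonneg hΔ.1 y, by linarith [hs.1], fun k hk hpos => ?_⟩
    obtain ⟨σ, hσ, hkσ⟩ := (weightVector_pos_iff hΔ.1 y k).1 hpos
    linarith [hs.2 σ hσ k hkσ hk]
  | zero => simp
  | add a b _ _ iha ihb =>
    simp only [Pi.add_apply, add_dotProduct, Finset.sum_add_distrib, add_mul]
    refine ⟨fun k => add_nonneg (iha.1 k) (ihb.1 k), add_le_add iha.2.1 ihb.2.1, ?_⟩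
    intro k hk hpos
    rcases (iha.1 k).lt_or_eq with h | h
    -- If the sum is positive at `k`, so is one of the summands, and its strictness suffices.
    · exact add_lt_add_of_lt_of_le (iha.2.2 k hk h) ihb.2.1
    · exact add_lt_add_of_le_of_lt iha.2.1 (ihb.2.2 k hk (by linarith))
  | smul c a _ iha =>
    have hc : (0 : ℝ) ≤ c := c.2
    have hsm : c • a = (c : ℝ) • a := rfl
    rw [hsm]
    simp only [Pi.smul_apply, smul_eq_mul, smul_dotProduct, ← Finset.mul_sum, mul_assoc]
    refine ⟨fun k => mul_nonneg hc (iha.1 k), mul_le_mul_of_nonneg_left iha.2.1 hc, ?_⟩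
    intro k hk hpos
    have hc' : (0 : ℝ) < c := pos_of_mul_pos_left hpos (iha.1 k)
    exact mul_lt_mul_of_pos_left (iha.2.2 k hk (pos_of_mul_pos_right hpos hc)) hc'

/-- Scaled subgradients of the tent integral lie in the cone of the weight vectors. -/
lemma mem_cone_of_subgradient (hdim : affineSpan ℝ (range X) = ⊤) (h1 : tentIntegral X y = 1)
    (hW : 0 < ∑ k, w k)
    (h : ∀ z, w ⬝ᵥ (z - y) ≤ (∑ k, w k) * (tentIntegral X z - 1)) :
    w ∈ PointedCone.hull ℝ (weightVector X y '' refiningTriangulations X y) := by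
  set W := ∑ k, w k with hWdef
  set K := weightVector X y '' refiningTriangulations X y with hK
  suffices hmem : W⁻¹ • w ∈ convexHull ℝ K by
    have h2 := convexHull_min (PointedCone.subset_hull (R := ℝ) (s := K))
      (PointedCone.convex _) hmem
    have h3 := PointedCone.smul_mem _ hW.le h2
    rwa [smul_smul, mul_inv_cancel₀ hW.ne', one_smul] at h3
  by_contra hnot
  have hfin : K.Finite := (toFinite _).image _
  obtain ⟨f, a, hfa, hfK⟩ := geometric_hahn_banach_point_closed (convex_convexHull ℝ K)
    (hfin.isCompact_convexHull ℝ).isClosed hnot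
  -- The separating functional with its sign reversed: `W⁻¹ • w` has a larger product with `v` than
  -- every weight vector at `y`.
  set v : Fin n → ℝ := fun k => -f (Pi.single k 1) with hv
  have hfv : ∀ x, f x = -(x ⬝ᵥ v) := by
    intro x
    conv_lhs => rw [← Finset.univ_sum_single x, map_sum]
    rw [dotProduct, ← Finset.sum_neg_distrib]
    refine Finset.sum_congr rfl fun k _ => ?_
    have : (Pi.single k (x k) : Fin n → ℝ) = x k • Pi.single k (1 : ℝ) := by
      rw [← Pi.single_smul, smul_eq_mul, mul_one]
    rw [this, map_smul, smul_eq_mul, hv]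
    ring
  have hlim : Filter.Tendsto (fun m : ℕ => y + (1 / ((m : ℝ) + 1)) • v) Filter.atTop (nhds y) := by
    have := (tendsto_one_div_add_atTop_nhds_zero_nat (𝕜 := ℝ)).smul_const v
    simpa using this.const_add y
  obtain ⟨Δ, hΔ, hfreq⟩ := exists_frequently_refining (X := X)
    (fun m => refiningTriangulations_nonempty X _) hlim
  have hle : w ⬝ᵥ v ≤ W * (weightVector X y Δ ⬝ᵥ v) := by
    have hcl : IsClosed {z | w ⬝ᵥ v ≤ W * (weightVector X z Δ ⬝ᵥ v)} := by
      refine isClosed_le continuous_const (continuous_const.mul ?_)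
      exact (continuous_weightVector X Δ).dotProduct continuous_const
    refine hcl.mem_of_frequently_of_tendsto (hfreq.mono fun m hm => ?_) hlim
    set ε : ℝ := 1 / ((m : ℝ) + 1) with hε
    have hεpos : 0 < ε := Nat.one_div_pos_of_nat
    -- The subgradient inequality based at `y + ε • v` is tested at `y`, against the hypothesis on
    -- `w` tested at `y + ε • v`. The tent integrals cancel and `ε` divides out.
    have hs := (tentIntegral_subgradient hdim hm y).1
    have hz := h (y + ε • v)
    rw [add_sub_cancel_left, dotProduct_smul, smul_eq_mul] at hz
    rw [sub_add_cancel_left, h1, dotProduct_neg, dotProduct_smul, smul_eq_mul] at hs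
    have : ε * (w ⬝ᵥ v) ≤ ε * (W * (weightVector X (y + ε • v) Δ ⬝ᵥ v)) := by
      refine hz.trans ?_
      rw [mul_left_comm]
      exact mul_le_mul_of_nonneg_left (by linarith) hW.le
    exact le_of_mul_le_mul_left this hεpos
  have hK' := hfK _ (subset_convexHull ℝ K ⟨Δ, hΔ, rfl⟩)
  rw [hfv] at hfa hK'
  rw [smul_dotProduct, smul_eq_mul] at hfa
  have : W⁻¹ * (w ⬝ᵥ v) ≤ weightVector X y Δ ⬝ᵥ v := by
    rw [inv_mul_le_iff₀ hW]
    exact hle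
  linarith

/-- Subtracting `log (tentIntegral X z)` makes any `z` feasible, which bounds `w ⬝ᵥ (z - y)` by the
total mass times that logarithm; then `log x ≤ x - 1`. -/
lemma subgradient_of_isOptimal (hdim : affineSpan ℝ (range X) = ⊤) (hW : 0 < ∑ k, w k)
    (h : IsOptimal (samworthBody X) (fun z => w ⬝ᵥ z) y) (z : Fin n → ℝ) :
    w ⬝ᵥ (z - y) ≤ (∑ k, w k) * (tentIntegral X z - 1) := by
  have h2 := h.2 _ (tentIntegral_normalize hdim z).le
  simp only [dotProduct_add_const] at h2
  rw [dotProduct_sub]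
  have := mul_le_mul_of_nonneg_left
    (Real.log_le_sub_one_of_pos (tentIntegral_pos hdim z)) hW.le
  linarith

/-- Normalizing a feasible `z` only raises it, and its tent lies above it at each `x_i`. Relevance
of `y` identifies the likelihood of its tent density with `w ⬝ᵥ y`. -/
lemma isOptimal_samworthBody_of_logLikelihood (hdim : affineSpan ℝ (range X) = ⊤)
    (hy : IsRelevant X y) (h1 : tentIntegral X y = 1) (hw : ∀ i, 0 < w i)
    (h : IsOptimal {f | IsLogConcaveDensity f} (logLikelihood X w) (density X y)) :
    IsOptimal (samworthBody X) (fun z => w ⬝ᵥ z) y := by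
  refine ⟨h1.le, fun z hz => ?_⟩
  have hz : tentIntegral X z ≤ 1 := hz
  have hpos := tentIntegral_pos hdim z
  have h2 := h.2 _ (isLogConcaveDensity_density hdim (tentIntegral_normalize hdim z))
  rw [logLikelihood_density, logLikelihood_density, EReal.coe_le_coe_iff] at h2
  simp only [hy _] at h2
  refine le_trans (Finset.sum_le_sum fun i _ => mul_le_mul_of_nonneg_left ?_ (hw i).le) h2
  have := le_tent_vertex X (fun k => z k + -Real.log (tentIntegral X z)) i
  linarith [Real.log_nonpos hpos.le hz]

/-- A log-concave density whose likelihood is at least that of the tent density is equal to it. -/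
lemma logLikelihood_le (hdim : affineSpan ℝ (range X) = ⊤) (h1 : tentIntegral X y = 1)
    (hw : ∀ i, 0 < w i) (hW : 0 < ∑ k, w k)
    (h : ∀ z, z ≠ y → w ⬝ᵥ (z - y) < (∑ k, w k) * (tentIntegral X z - 1))
    {f : (Fin d → ℝ) → ℝ} (hf : IsLogConcaveDensity f) :
    logLikelihood X w f ≤ ((w ⬝ᵥ y : ℝ) : EReal) ∧
      (((w ⬝ᵥ y : ℝ) : EReal) ≤ logLikelihood X w f → f = density X y) := by
  by_cases hpos : ∀ i, 0 < f (X i)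
  · set z : Fin n → ℝ := fun i => Real.log (f (X i)) with hz
    have hle : ∀ t, density X z t ≤ f t :=
      hf.density_le fun i => (Real.exp_log (hpos i)).le
    have hint : tentIntegral X z ≤ 1 := by
      rw [← integral_density, ← hf.2.2.2]
      exact integral_mono (integrable_density hdim z) hf.2.2.1 hle
    rw [logLikelihood_of_pos hpos, EReal.coe_le_coe_iff, EReal.coe_le_coe_iff]
    by_cases hzy : z = y
    · rw [hzy] at hle
      exact ⟨by rw [← hz, hzy], fun _ => hf.eq_density hdim h1 hle⟩
    · have hlt := h z hzy
      rw [dotProduct_sub] at hlt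
      have : (∑ k, w k) * (tentIntegral X z - 1) ≤ 0 :=
        mul_nonpos_of_nonneg_of_nonpos hW.le (by linarith)
      exact ⟨by linarith, fun hcon => by linarith⟩
  · push Not at hpos
    obtain ⟨i, hi⟩ := hpos
    rw [logLikelihood_of_nonpos (hw i) hi]
    exact ⟨bot_le, fun hcon => absurd (le_bot_iff.1 hcon) (EReal.coe_ne_bot _)⟩

end Optimality

end

end LogConcaveMLE

/-! ### Assembly of the equivalences -/

open LogConcaveMLE in
theorem theorem3p6 {n d : ℕ} (X : Fin n → Fin d → ℝ)
    (hX : Function.Injective X) (hdim : affineSpan ℝ (Set.range X) = ⊤)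
    (y : Fin n → ℝ) (hy : IsRelevant X y) (hint : ∫ t, density X y t = 1) :
    (∀ Δ ∈ refiningTriangulations X y, ∀ k,
      0 ≤ weightVector X y Δ k ∧ (0 < weightVector X y Δ k ↔ ∃ σ ∈ Δ, k ∈ σ)) ∧
    ∀ w : Fin n → ℝ, (∀ i, 0 < w i) →
      List.TFAE [
        w ∈ PointedCone.hull ℝ (weightVector X y '' refiningTriangulations X y),
        IsOptimal {f | IsLogConcaveDensity f} (logLikelihood X w) (density X y),
        IsUniqueOptimal {f | IsLogConcaveDensity f} (logLikelihood X w) (density X y),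
        IsOptimal (samworthBody X) (fun z => w ⬝ᵥ z) y,
        IsUniqueOptimal (samworthBody X) (fun z => w ⬝ᵥ z) y] ∧
      (∑ i, w i = 1 → List.TFAE [
        w ∈ PointedCone.hull ℝ (weightVector X y '' refiningTriangulations X y),
        IsOptimal Set.univ (unconstrainedObjective X w) y,
        IsUniqueOptimal Set.univ (unconstrainedObjective X w) y,
        ∃ Δ, IsOptimal (triangulationPairs X) (triangulationObjective X w) (y, Δ),
        (∃ Δ, (y, Δ) ∈ triangulationPairs X) ∧
          ∀ p, IsOptimal (triangulationPairs X) (triangulationObjective X w) p ↔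
            p ∈ triangulationPairs X ∧ p.1 = y]) := by
  have h1 : tentIntegral X y = 1 := by rw [← integral_density, hint]
  refine ⟨fun Δ hΔ k => ⟨weightVector_nonneg hΔ.1 y k, weightVector_pos_iff hΔ.1 y k⟩,
    fun w hw => ?_⟩
  -- There is at least one label, even for `d = 0`, because the affine span is nonempty.
  have hW : 0 < ∑ k, w k := by
    refine Finset.sum_pos (fun i _ => hw i) ?_
    rw [Finset.univ_nonempty_iff, ← Set.range_nonempty_iff_nonempty (f := X),
      ← affineSpan_nonempty ℝ, hdim]
    exact Set.univ_nonempty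
  have hstrict : w ∈ PointedCone.hull ℝ (weightVector X y '' refiningTriangulations X y) →
      ∀ z, z ≠ y → w ⬝ᵥ (z - y) < (∑ k, w k) * (tentIntegral X z - 1) := by
    intro ha z hzy
    obtain ⟨k, hk⟩ := Function.ne_iff.1 hzy
    exact (subgradient_of_mem_cone hdim h1 ha z).2.2 k hk (hw k)
  have hlik : logLikelihood X w (density X y) = ((w ⬝ᵥ y : ℝ) : EReal) := by
    rw [logLikelihood_density]
    simp only [hy _]
    rfl
  constructor
  · tfae_have 1 → 3 := by
      intro ha
      have hle := fun f hf => logLikelihood_le hdim h1 hw hW (hstrict ha) (f := f) hf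
      refine ⟨⟨isLogConcaveDensity_density hdim h1, fun f hf => ?_⟩, fun f hf => ?_⟩
      · rw [hlik]
        exact (hle f hf).1
      · refine (hle f hf.1).2 ?_
        rw [← hlik]
        exact hf.2 _ (isLogConcaveDensity_density hdim h1)
    tfae_have 3 → 2 := fun h => h.1
    tfae_have 2 → 4 := isOptimal_samworthBody_of_logLikelihood hdim hy h1 hw
    tfae_have 4 → 1 := fun h =>
      mem_cone_of_subgradient hdim h1 hW (subgradient_of_isOptimal hdim hW h)
    tfae_have 1 → 5 := by
      intro ha
      have hlt : ∀ z ∈ samworthBody X, z ≠ y → w ⬝ᵥ z < w ⬝ᵥ y := by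
        intro z hz hzy
        have hz : tentIntegral X z ≤ 1 := hz
        have h2 := hstrict ha z hzy
        rw [dotProduct_sub] at h2
        have := mul_nonpos_of_nonneg_of_nonpos hW.le (sub_nonpos.2 hz)
        linarith
      refine ⟨⟨h1.le, fun z hz => ?_⟩, fun z hz => ?_⟩
      · by_cases hzy : z = y
        · rw [hzy]
        · exact (hlt z hz hzy).le
      · by_contra hzy
        exact (hlt z hz.1 hzy).not_ge (hz.2 y h1.le)
    tfae_have 5 → 4 := fun h => h.1
    tfae_finish
  · intro hw1
    have hobj : ∀ p ∈ triangulationPairs X,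
        triangulationObjective X w p = unconstrainedObjective X w p.1 :=
      fun p hp => triangulationObjective_eq hdim w hp
    tfae_have 1 → 3 := by
      intro ha
      have hlt : ∀ z, z ≠ y → unconstrainedObjective X w z < unconstrainedObjective X w y := by
        intro z hzy
        have h2 := hstrict ha z hzy
        rw [dotProduct_sub, hw1, one_mul] at h2
        rw [unconstrainedObjective, unconstrainedObjective, h1]
        linarith
      refine ⟨⟨Set.mem_univ _, fun z _ => ?_⟩, fun z hz => ?_⟩
      · by_cases hzy : z = y
        · rw [hzy]
        · exact (hlt z hzy).le
      · by_contra hzy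
        exact (hlt z hzy).not_ge (hz.2 y (Set.mem_univ _))
    tfae_have 3 → 2 := fun h => h.1
    tfae_have 2 → 1 := by
      intro h
      -- With total mass `1`, unconstrained optimality is the subgradient inequality itself.
      refine mem_cone_of_subgradient hdim h1 hW fun z => ?_
      have h2 := h.2 z (Set.mem_univ _)
      rw [unconstrainedObjective, unconstrainedObjective, h1] at h2
      rw [dotProduct_sub, hw1, one_mul]
      linarith
    tfae_have 3 → 5 := by
      intro h
      obtain ⟨Δ, hΔ⟩ := refiningTriangulations_nonempty X y
      refine ⟨⟨Δ, hΔ⟩, fun p => ⟨fun hp => ⟨hp.1, ?_⟩, fun hp => ⟨hp.1, fun q hq => ?_⟩⟩⟩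
      · refine h.2 p.1 ⟨Set.mem_univ _, fun z _ => ?_⟩
        have hle := hp.2 (y, Δ) hΔ
        rw [hobj _ hp.1, hobj (y, Δ) hΔ] at hle
        exact (h.1.2 z (Set.mem_univ _)).trans hle
      · rw [hobj p hp.1, hobj q hq, hp.2]
        exact h.1.2 _ (Set.mem_univ _)
    tfae_have 5 → 4 := by
      rintro ⟨⟨Δ, hΔ⟩, h⟩
      exact ⟨Δ, (h _).2 ⟨hΔ, rfl⟩⟩
    tfae_have 4 → 2 := by
      rintro ⟨Δ, hΔ⟩
      refine ⟨Set.mem_univ _, fun z _ => ?_⟩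
      -- Every height vector occurs in a feasible pair, so the triangulation problem covers all
      -- competitors `z`.
      obtain ⟨Δ', hΔ'⟩ := refiningTriangulations_nonempty X z
      have hle := hΔ.2 (z, Δ') hΔ'
      rwa [hobj _ hΔ.1, hobj (z, Δ') hΔ'] at hle
    tfae_finish
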